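/- Let $G$ be a commutative algebraic group over a finite field $\mathbb F_q$, embedded as a Zariski locally closed subset of $\mathbb P^n$ over $\mathbb F_q$, and identified with its set of points in an algebraically closed field $\mathcal U\supseteq\mathbb F_q$. Fix a defining set of polynomials over $\mathbb F_q$ for the group operation: a finite cover of $G\times G$ by open subsets defined over $\mathbb F_q$, and for each member $O$ of the cover a tuple $(P_0,\dots,P_n)$ of polynomials in $\mathbb F_q[x_0,\dots,x_n;y_0,\dots,y_n]$, bihomogeneous of a common bidegree, without common zeros on $O$, such that $a+b=[P_0(a,b):\cdots:P_n(a,b)]$ for $(a,b)\in O$. Let $F:G\to G$ be the endomorphism induced by the $q$-power Frobenius map. Let $r>0$ be such that all these polynomials $P_i$ have total degree at most $q^r$, let $K\subseteq\mathcal U$ be a finitely generated field extension of $\mathbb F_{q^r}$, let $X\subseteq G$ be a closed subvariety (not necessarily irreducible) defined over $K$, and let $\Sigma\subseteq G(K)$ be finite. For $\ell\ge 0$ let $\Sigma(\ell,F^r)$ be the set of all $x_0+F^rx_1+\cdots+F^{r(m-1)}x_{m-1}$ with $0\le m\le\ell$ and $x_0,\dots,x_{m-1}\in\Sigma$. For a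 closed subvariety $V\subseteq G$ let $V^{q^{-m}}$ be the closed subvariety of $G$ obtained by replacing the coefficients of the defining equations of $V$ by their $q^m$-th roots, and let $V(K)$ be the set of $K$-rational points of $V$. Then the collection $$\mathcal T_K:=\big\{(X-\gamma)^{q^{-\ell r}}(K):\ \ell\ge 0,\ \gamma\in\Sigma(\ell,F^r)\big\}$$ is finite. Moreover, a bound on $|\mathcal T_K|$ is effectively computable: there is a computable function $B$ such that $|\mathcal T_K|\le B(D)$ whenever $D$ is a finite presentation of the data, consisting of the characteristic $p$, the numbers $q$, $r$, $n$, a presentation of $K$ as the fraction field of $\mathbb F_p[T_1,\dots,T_s]/I$ with $I$ given by generators, the polynomials over $\mathbb F_q$ defining $G\subseteq\mathbb P^n$ and its group operation, homogeneous polynomials over $K$ defining $X$ in $G$, and homogeneous coordinates in $K$ of the points of $\Sigma$ (elements of $K$ being written as fractions of polynomials in the generators $T_i$). -/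

import Mathlib

noncomputable section

open MvPolynomial

/-! ## Points of projective space over an algebraically closed field -/

/-- The points of projective `n`-space with coordinates in the field `U`. -/
abbrev ProjPts (U : Type*) [Field U] (n : ℕ) : Type _ := Projectivization U (Fin (n + 1) → U)

/-- The form `f` vanishes at the point `x`.  This is used only for homogeneous `f`, where it does
not depend on the choice of homogeneous coordinates of `x`. -/
def VanishesAt {R U : Type*} [CommRing R] [Field U] [Algebra R U] {n : ℕ}
    (f : MvPolynomial (Fin (n + 1)) R) (x : ProjPts U n) : Prop :=
  aeval x.rep f = 0

/-- The Zariski locally closed subset of projective space where all the forms of the list `eqs`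
vanish and at least one of the forms of the list `bdry` does not vanish. -/
def locClosed {R : Type*} (U : Type*) [CommRing R] [Field U] [Algebra R U] {n : ℕ}
    (eqs bdry : List (MvPolynomial (Fin (n + 1)) R)) : Set (ProjPts U n) :=
  {x | (∀ f ∈ eqs, VanishesAt f x) ∧ ∃ g ∈ bdry, ¬ VanishesAt g x}

/-- The point `x` is `K`-rational: it has homogeneous coordinates in `K`. -/
def IsRationalPt (K : Type*) {U : Type*} [Field K] [Field U] [Algebra K U] {n : ℕ}
    (x : ProjPts U n) : Prop :=
  ∃ (v : Fin (n + 1) → K) (h : (fun i => algebraMap K U (v i)) ≠ 0),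
    x = Projectivization.mk U (fun i => algebraMap K U (v i)) h

/-! ## Commutative algebraic groups embedded in projective space -/

/-- A polynomial in two groups of `n + 1` variables that is homogeneous of degree `d` in the
first group and homogeneous of degree `e` in the second group. -/
def IsBihomogeneous {R : Type*} [CommRing R] {n : ℕ}
    (f : MvPolynomial (Fin (n + 1) ⊕ Fin (n + 1)) R) (d e : ℕ) : Prop :=
  IsWeightedHomogeneous (Sum.elim (fun _ => 1) (fun _ => 0) : _ → ℕ) f d ∧
    IsWeightedHomogeneous (Sum.elim (fun _ => 0) (fun _ => 1) : _ → ℕ) f e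

/-- Value of `f` at the chosen homogeneous coordinates of `x` and `y`. -/
def evalPair {R U : Type*} [CommRing R] [Field U] [Algebra R U] {n : ℕ}
    (f : MvPolynomial (Fin (n + 1) ⊕ Fin (n + 1)) R) (x y : ProjPts U n) : U :=
  aeval (Sum.elim x.rep y.rep) f

/-- Polynomials describing a map from an open subset of a product of two copies of projective
`n`-space to projective `n`-space: the open set is where some member of `opens` does not vanish,
the homogeneous coordinates of the image are given by `coord`. -/
structure BiChart (R : Type*) [CommRing R] (n : ℕ) where
  opens : List (MvPolynomial (Fin (n + 1) ⊕ Fin (n + 1)) R)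
  coord : Fin (n + 1) → MvPolynomial (Fin (n + 1) ⊕ Fin (n + 1)) R
  opens_bihomogeneous : ∀ g ∈ opens, ∃ d e, IsBihomogeneous g d e
  coord_bihomogeneous : ∃ d e, ∀ i, IsBihomogeneous (coord i) d e

/-- The pair `(x, y)` lies in the open set of the chart. -/
def BiChart.Dom {R U : Type*} [CommRing R] [Field U] [Algebra R U] {n : ℕ}
    (c : BiChart R n) (x y : ProjPts U n) : Prop :=
  ∃ g ∈ c.opens, evalPair g x y ≠ 0

/-- A commutative algebraic group over `k`, identified with its set of points in the algebraically
closed field `U`, together with a presentation: an embedding as a locally closed subset of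
projective `n`-space over `k`, and a defining set of polynomials over `k` for the group
operation, i.e. finitely many charts over `k` whose open sets cover `G × G` and on each of which
the given coordinate polynomials have no common zero and compute the sum.  The inverse is a
regular map over `k` as well. -/
structure CommAlgGroup (k U : Type*) [Field k] [Field U] [Algebra k U] (n : ℕ) where
  eqs : List (MvPolynomial (Fin (n + 1)) k)
  bdry : List (MvPolynomial (Fin (n + 1)) k)
  eqs_homogeneous : ∀ f ∈ eqs, ∃ d, f.IsHomogeneous d
  bdry_homogeneous : ∀ f ∈ bdry, ∃ d, f.IsHomogeneous d
  group : AddCommGroup (locClosed U eqs bdry)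
  law : List (BiChart k n)
  law_cover : ∀ x y : locClosed U eqs bdry, ∃ c ∈ law, c.Dom x.1 y.1
  law_add : ∀ c ∈ law, ∀ x y : locClosed U eqs bdry, c.Dom x.1 y.1 →
    ∃ h : (fun i => evalPair (c.coord i) x.1 y.1) ≠ 0,
      (x + y).1 = Projectivization.mk U (fun i => evalPair (c.coord i) x.1 y.1) h
  neg_regular : ∀ x : locClosed U eqs bdry,
    ∃ (g : MvPolynomial (Fin (n + 1)) k) (N : Fin (n + 1) → MvPolynomial (Fin (n + 1)) k)
      (d e : ℕ), g.IsHomogeneous d ∧ (∀ i, (N i).IsHomogeneous e) ∧ ¬ VanishesAt g x.1 ∧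
      ∀ y : locClosed U eqs bdry, ¬ VanishesAt g y.1 →
        ∃ h : (fun i => aeval y.1.rep (N i)) ≠ 0,
          (-y).1 = Projectivization.mk U (fun i => aeval y.1.rep (N i)) h

/-- The set of `U`-points of `G`. -/
abbrev CommAlgGroup.Pts {k U : Type*} [Field k] [Field U] [Algebra k U] {n : ℕ}
    (G : CommAlgGroup k U n) : Type _ :=
  locClosed U G.eqs G.bdry

instance {k U : Type*} [Field k] [Field U] [Algebra k U] {n : ℕ}
    (G : CommAlgGroup k U n) : AddCommGroup G.Pts :=
  G.group

/-! ## Frobenius -/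

/-- Raising all coordinates to the `q`-th power, `q` the number of elements of `k`. -/
def frobVec (k U : Type*) [Field k] [Fintype k] [Field U] [Algebra k U] (n : ℕ) :
    (Fin (n + 1) → U) →ₛₗ[(FiniteField.frobeniusAlgHom k U : U →+* U)] (Fin (n + 1) → U) where
  toFun v i := v i ^ Fintype.card k
  map_add' v w := by
    funext i
    simpa using map_add (FiniteField.frobeniusAlgHom k U) (v i) (w i)
  map_smul' a v := by
    funext i
    simp [mul_pow]

theorem frobVec_injective (k U : Type*) [Field k] [Fintype k] [Field U] [Algebra k U] (n : ℕ) :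
    Function.Injective (frobVec k U n) := by
  intro v w h
  funext i
  have h1 : (FiniteField.frobeniusAlgHom k U) (v i) = (FiniteField.frobeniusAlgHom k U) (w i) := by
    exact congrFun h i
  exact (FiniteField.frobeniusAlgHom k U).toRingHom.injective h1

/-- The `q`-power Frobenius map on projective space, `q` the number of elements of `k`. -/
def frobProj (k : Type*) {U : Type*} [Field k] [Fintype k] [Field U] [Algebra k U] {n : ℕ} :
    ProjPts U n → ProjPts U n :=
  Projectivization.map (frobVec k U n) (frobVec_injective k U n)

theorem vanishesAt_mk_iff {R U : Type*} [CommRing R] [Field U] [Algebra R U] {n d : ℕ}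
    {f : MvPolynomial (Fin (n + 1)) R} (hf : f.IsHomogeneous d) (v : Fin (n + 1) → U)
    (hv : v ≠ 0) : VanishesAt f (Projectivization.mk U v hv) ↔ aeval v f = 0 := by
  obtain ⟨a, ha⟩ := Projectivization.exists_smul_eq_mk_rep U v hv
  have h1 : aeval ((a : U) • v) f = (a : U) ^ d * aeval v f := by
    rw [aeval_def, aeval_def, eval₂_eq', eval₂_eq', Finset.mul_sum]
    refine Finset.sum_congr rfl fun s hs => ?_
    have hd : ∑ i, s i = d := by
      have := hf (mem_support_iff.mp hs)
      rw [← this, Finsupp.weight_apply, Finsupp.sum_fintype _ _ (by simp)]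
      simp
    simp only [Pi.smul_apply, smul_eq_mul, mul_pow, Finset.prod_mul_distrib,
      Finset.prod_pow_eq_pow_sum, hd]
    ring
  unfold VanishesAt
  rw [← ha, Units.smul_def, h1]
  simp

theorem vanishesAt_frobProj_iff {k U : Type*} [Field k] [Fintype k] [Field U] [Algebra k U]
    {n d : ℕ} {f : MvPolynomial (Fin (n + 1)) k} (hf : f.IsHomogeneous d) (x : ProjPts U n) :
    VanishesAt f (frobProj k x) ↔ VanishesAt f x := by
  have hx : frobProj k x = Projectivization.mk U (frobVec k U n x.rep)
      ((map_ne_zero_iff _ (frobVec_injective k U n)).2 x.rep_nonzero) := by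
    conv_lhs => rw [← x.mk_rep]
    rfl
  rw [hx, vanishesAt_mk_iff hf]
  have h1 : aeval (frobVec k U n x.rep) f = (FiniteField.frobeniusAlgHom k U) (aeval x.rep f) := by
    rw [← AlgHom.comp_apply, comp_aeval]
    rfl
  rw [h1]
  exact map_eq_zero_iff (FiniteField.frobeniusAlgHom k U).toRingHom
    (FiniteField.frobeniusAlgHom k U).toRingHom.injective

/-- The endomorphism `F : G → G` induced by the `q`-power Frobenius map. -/
def CommAlgGroup.frob {k U : Type*} [Field k] [Fintype k] [Field U] [Algebra k U] {n : ℕ}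
    (G : CommAlgGroup k U n) : G.Pts → G.Pts := fun x =>
  ⟨frobProj k x.1, by
    obtain ⟨h1, g, hg, h2⟩ := x.2
    refine ⟨fun f hf => ?_, g, hg, ?_⟩
    · obtain ⟨d, hd⟩ := G.eqs_homogeneous f hf
      exact (vanishesAt_frobProj_iff hd _).2 (h1 f hf)
    · obtain ⟨d, hd⟩ := G.bdry_homogeneous g hg
      exact fun h => h2 ((vanishesAt_frobProj_iff hd _).1 h)⟩

/-- The `F`-expansion `x₀ + F x₁ + ⋯ + F^m x_m` of the word `w = x₀ x₁ ⋯ x_m` (it is `0` for the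
empty word). -/
def expansion {M : Type*} [AddCommGroup M] (F : M → M) (w : List M) : M :=
  ∑ i : Fin w.length, F^[(i : ℕ)] (w.get i)

/-- The set `Σ(ℓ, F)` of `F`-expansions of words over `S` of length at most `ℓ`. -/
def expansions {M : Type*} [AddCommGroup M] (S : Set M) (l : ℕ) (F : M → M) : Set M :=
  {γ | ∃ w : List M, (∀ x ∈ w, x ∈ S) ∧ w.length ≤ l ∧ expansion F w = γ}

/-! ## Subvarieties and their Frobenius transforms -/

namespace CommAlgGroup

variable {k U : Type*} [Field k] [Field U] [Algebra k U] {n : ℕ} (G : CommAlgGroup k U n)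

/-- The set `X` is the closed subset of `G` defined by the forms `Q` with coefficients in `K`. -/
def IsDefinedBy {K : Type*} [Field K] [Algebra K U] (X : Set G.Pts)
    (Q : List (MvPolynomial (Fin (n + 1)) K)) : Prop :=
  (∀ f ∈ Q, ∃ d, f.IsHomogeneous d) ∧ X = {x | ∀ f ∈ Q, VanishesAt f x.1}

/-- `X` is a closed subvariety of `G` (not necessarily irreducible) defined over `K`. -/
def IsClosedSubvariety (K : Type*) [Field K] [Algebra K U] (X : Set G.Pts) : Prop :=
  ∃ Q : List (MvPolynomial (Fin (n + 1)) K), G.IsDefinedBy X Q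

/-- The transform `V^{q^{-m}}` of a closed subvariety `V` of `G` by the inverse of the `m`-th power
of the `q`-power Frobenius (`q` the number of elements of `k`): the closed subvariety of `G`
whose defining equations `f` are obtained from the defining equations `g` of `V` by replacing
all coefficients by their `q^m`-th roots. -/
def frobTransform [Fintype k] (V : Set G.Pts) (m : ℕ) : Set G.Pts :=
  {x | ∀ (d : ℕ) (f g : MvPolynomial (Fin (n + 1)) U), g.IsHomogeneous d →
    (∀ v ∈ V, VanishesAt g v.1) →
    (∀ s, f.coeff s ^ Fintype.card k ^ m = g.coeff s) → VanishesAt f x.1}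

/-- The set `V(K)` of `K`-rational points of `V`. -/
def ratPoints (K : Type*) [Field K] [Algebra K U] (V : Set G.Pts) : Set G.Pts :=
  {x | x ∈ V ∧ IsRationalPt K x.1}

/-- The collection of all sets `(X - γ)^{q^{-ℓr}}(K)` with `ℓ ≥ 0` and `γ ∈ Σ(ℓ, F^r)`. -/
def pullbackSets [Fintype k] (K : Type*) [Field K] [Algebra K U] (X S : Set G.Pts) (r : ℕ) :
    Set (Set G.Pts) :=
  {T | ∃ (l : ℕ) (γ : G.Pts), γ ∈ expansions S l (G.frob^[r]) ∧
    T = G.ratPoints K (G.frobTransform ((fun x => x - γ) '' X) (l * r))}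

end CommAlgGroup

/-! ## Finite presentations of the data

Everything is written down with natural numbers.  The field `K` is the fraction field of
`𝔽_p[T_1, …, T_s] / I`, where `I` is given by generators; elements of `K` are quotients of
polynomials in the classes of the `T_i`. -/

/-- A polynomial over the prime field: a list of terms (coefficient, list of exponents). -/
abbrev PolyCode : Type := List (ℕ × List ℕ)

/-- An element of `K`: numerator and denominator. -/
abbrev FracCode : Type := PolyCode × PolyCode

/-- A polynomial with coefficients in `K`: a list of terms (coefficient, list of exponents). -/
abbrev KPolyCode : Type := List (FracCode × List ℕ)

/-- The polynomial with given list of terms; the variable `i` has its exponent at position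
`pos i` of the lists of exponents, and exponents past the end of a list are `0`. -/
def decodeTerms {C R σ : Type*} [CommSemiring R] [Finite σ] (val : C → R) (pos : σ → ℕ)
    (L : List (C × List ℕ)) : MvPolynomial σ R :=
  (L.map fun t =>
    monomial (Finsupp.equivFunOnFinite.symm fun i => t.2.getD (pos i) 0) (val t.1)).sum

/-- The polynomial over `𝔽_p` in `s` variables with code `t`. -/
def PolyCode.toPoly (p s : ℕ) (t : PolyCode) : MvPolynomial (Fin s) (ZMod p) :=
  decodeTerms (fun a : ℕ => (a : ZMod p)) (fun i => (i : ℕ)) t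

section Decoding

variable {K : Type*} [Field K] (p : ℕ) [Algebra (ZMod p) K] {s : ℕ} (c : Fin s → K)

/-- The denominator does not vanish in `K`. -/
def FracCode.Valid (a : FracCode) : Prop := aeval c (PolyCode.toPoly p s a.2) ≠ 0

/-- The element of `K` with code `a`. -/
def FracCode.value (a : FracCode) : K :=
  aeval c (PolyCode.toPoly p s a.1) / aeval c (PolyCode.toPoly p s a.2)

/-- `t` is a code of the polynomial `f` over `K`, the variables being ordered by `pos`. -/
def KPolyCode.Codes {σ : Type*} [Finite σ] (pos : σ → ℕ) (t : KPolyCode)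
    (f : MvPolynomial σ K) : Prop :=
  (∀ a ∈ t, FracCode.Valid p c a.1) ∧ decodeTerms (FracCode.value p c) pos t = f

/-- `t` is a code of the point `x`: a list of homogeneous coordinates of `x` in `K`. -/
def CodesPoint {U : Type*} [Field U] [Algebra K U] {n : ℕ} (t : List FracCode)
    (x : ProjPts U n) : Prop :=
  t.length = n + 1 ∧ (∀ a ∈ t, FracCode.Valid p c a) ∧
    ∃ h : (fun i : Fin (n + 1) =>
        algebraMap K U (FracCode.value p c (t.getD (i : ℕ) ([], [])))) ≠ 0,
      x = Projectivization.mk U _ h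

end Decoding

/-- The positions of the variables `x_0, …, x_n` in a list of exponents. -/
def posOne (n : ℕ) : Fin (n + 1) → ℕ := fun i => i

/-- The positions of the variables `x_0, …, x_n, y_0, …, y_n` in a list of exponents. -/
def posTwo (n : ℕ) : Fin (n + 1) ⊕ Fin (n + 1) → ℕ :=
  Sum.elim (fun i => i) (fun i => n + 1 + i)

/-- `t` is a code of the chart `b` over the subfield `k` of `K`. -/
def CodesChart {k K : Type*} [Field k] [Field K] [Algebra k K] (p : ℕ) [Algebra (ZMod p) K]
    {s : ℕ} (c : Fin s → K) {n : ℕ} (t : List KPolyCode × List KPolyCode)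
    (b : BiChart k n) : Prop :=
  List.Forall₂ (fun u g => KPolyCode.Codes p c (posTwo n) u (map (algebraMap k K) g))
      t.1 b.opens ∧
    List.Forall₂ (fun u g => KPolyCode.Codes p c (posTwo n) u (map (algebraMap k K) g))
      t.2 (List.ofFn b.coord)

/-- The input of the effective bound. -/
structure InputCode where
  /-- the characteristic -/
  p : ℕ
  /-- the number of elements of the field of definition of the group -/
  q : ℕ
  /-- the exponent `r` -/
  r : ℕ
  /-- the dimension of the ambient projective space -/
  n : ℕ
  /-- the number of generators of `K` -/
  s : ℕ
  /-- generators of the ideal of relations between the generators of `K` -/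
  rels : List PolyCode
  /-- equations of the closure of the group -/
  eqs : List KPolyCode
  /-- equations of the boundary of the group -/
  bdry : List KPolyCode
  /-- the group law -/
  law : List (List KPolyCode × List KPolyCode)
  /-- equations of the subvariety -/
  sub : List KPolyCode
  /-- homogeneous coordinates of the points of the finite set -/
  pts : List (List FracCode)

/-- Inputs as tuples of numbers and lists, on which computability is defined. -/
abbrev InputTuple : Type :=
  (ℕ × ℕ × ℕ × ℕ × ℕ) × List PolyCode × List KPolyCode × List KPolyCode ×
    List (List KPolyCode × List KPolyCode) × List KPolyCode × List (List FracCode)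

/-- The tuple of all components. -/
def InputCode.toTuple (D : InputCode) : InputTuple :=
  ((D.p, D.q, D.r, D.n, D.s), D.rels, D.eqs, D.bdry, D.law, D.sub, D.pts)

/-- `D` is a presentation of the field `K` (with chosen generators `c`), the group `G`, the closed
subvariety `X`, the finite set `S` of points and the number `r`. -/
structure InputCode.Presents {k K U : Type*} [Field k] [Fintype k] [Field K] [Field U]
    [Algebra k K] [Algebra k U] [Algebra K U] {n : ℕ}
    (p : ℕ) [Fact p.Prime] [Algebra (ZMod p) K] (D : InputCode) (c : Fin D.s → K) (G : CommAlgGroup k U n) (X S : Set G.Pts)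
    (r : ℕ) : Prop where
  p_eq : D.p = p
  q_eq : D.q = Fintype.card k
  r_eq : D.r = r
  n_eq : D.n = n
  generate : IntermediateField.adjoin (ZMod p) (Set.range c) = ⊤
  relations : RingHom.ker (aeval c : MvPolynomial (Fin D.s) (ZMod p) →ₐ[ZMod p] K) =
    Ideal.span {f | ∃ t ∈ D.rels, f = PolyCode.toPoly p D.s t}
  eqs : List.Forall₂
    (fun t f => KPolyCode.Codes p c (posOne n) t (map (algebraMap k K) f)) D.eqs G.eqs
  bdry : List.Forall₂
    (fun t f => KPolyCode.Codes p c (posOne n) t (map (algebraMap k K) f)) D.bdry G.bdry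
  law : List.Forall₂ (CodesChart p c) D.law G.law
  sub : ∃ Q : List (MvPolynomial (Fin (n + 1)) K), G.IsDefinedBy X Q ∧
    List.Forall₂ (KPolyCode.Codes p c (posOne n)) D.sub Q
  pts_mem : ∀ x ∈ S, ∃ t ∈ D.pts, CodesPoint p c t x.1
  pts_all : ∀ t ∈ D.pts, ∃ x ∈ S, CodesPoint p c t x.1

end

/-!
The sets in question are determined, one for each `ℓ` and `γ`, by the condition
`F ^ (ℓ r) y + γ ∈ X` on the `K`-rational point `y` (`CommAlgGroup.mem_frobTransform_iff`).  They
are finitely many because each of them is defined over `K` by polynomials taken from one finite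
set.

Let `c` be generators of `K` over `𝔽_p`, and say that an element of `K` has size at most `N` if it
is a combination over `𝔽_p` of monomials in `c` with exponents at most `N` (`boxSpan`).

*Heights.*  Since the group law is given by polynomials of degree at most `Q = q ^ r`, adding the
letters of a word from the left to the right produces coordinates of
`x₀ + F ^ r x₁ + ⋯ + F ^ (r (m - 1)) x_{m - 1}` of size `O(Q ^ m)`
(`exists_hasCoords_expansion`): a partial sum enters the addition formula with degree less than
`Q`, unless the other summand does not enter at all.  Hence the condition on `y` says that some
polynomials of bounded degree, with coefficients of size `O(Q ^ ℓ)`, vanish at the `Q ^ ℓ`-th powers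
of the coordinates of `y` (`pullbackSets_subset_image_rootSets`).

*Descent.*  Expanding coefficients with respect to a basis of `K` over `K ^ p` and extracting
`p`-th roots replaces a linear equation in `p ^ (k + 1)`-th powers by a system in `p ^ k`-th
powers, and divides the sizes by `p` up to an additive constant.  After all Frobenius powers have
been removed the coefficients lie in a finite set independent of `ℓ` and `γ`
(`exists_linear_system`, `finite_rootSets`).

*Effectivity.*  The additive constant is governed by the structure constants of a basis of `K` over
`K ^ p`, for which a bound in terms of the degree `δ` of the relations between the generators is
needed (`exists_frobenius_basis`).  Among the relations and the coordinates one picks `a` relations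
with independent differentials at `c` and `s - a` complementary coordinates
(`exists_jacobian_splitting`).  The monomials with exponents less than `p` in these coordinates are
independent over `K ^ p`, since the corresponding vector fields separate them
(`eq_zero_of_sum_pow_mul_monomial_eq_zero`).  On the other hand the products of powers of the chosen
relations are independent over lifts of elements of `K`, as the lowest terms of Taylor expansions at
`c` show (`eq_zero_of_sum_prod_pow_mul_eq_zero`); counting dimensions in the polynomial ring bounds
the dimension of the space of elements of size at most `N` by an explicit constant times
`(N + 1) ^ (s - a)` (`pow_mul_finrank_boxSpan_le`).  So there is an explicitly bounded `N` such that
passing from `N` to `p N + p - 1` multiplies this dimension by less than `1 + p ^ (s - a)`, and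
then linear algebra over `𝔽_p` yields small structure constants (`exists_pow_mul_eq_sum`).  All
sizes are bounded by the code number of the presentation, and the resulting bound is a primitive
recursive function of it (`primrec_sizeBound`).
-/

noncomputable section

open MvPolynomial

/-! ### Spans of monomials with bounded exponents -/

/-- The `𝔽_p`-span of the monomials in the family `c` all of whose exponents are at most `N`. -/
def boxSpan (p : ℕ) {R : Type*} [CommRing R] [Algebra (ZMod p) R] {s : ℕ} (c : Fin s → R)
    (N : ℕ) : Submodule (ZMod p) R :=
  Submodule.span (ZMod p) (Set.range fun β : Fin s → Fin (N + 1) => ∏ i, c i ^ (β i : ℕ))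

section BoxSpan

variable {p : ℕ} {R : Type*} [CommRing R] [Algebra (ZMod p) R] {s : ℕ} {c : Fin s → R}

theorem monomial_mem_boxSpan {N : ℕ} (β : Fin s → ℕ) (h : ∀ i, β i ≤ N) :
    ∏ i, c i ^ β i ∈ boxSpan p c N :=
  Submodule.subset_span ⟨fun i => ⟨β i, Nat.lt_succ_of_le (h i)⟩, rfl⟩

theorem boxSpan_mono {M N : ℕ} (h : M ≤ N) : boxSpan p c M ≤ boxSpan p c N := by
  refine Submodule.span_le.2 ?_
  rintro _ ⟨β, rfl⟩
  exact monomial_mem_boxSpan _ fun i => (Nat.le_of_lt_succ (β i).2).trans h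

theorem one_mem_boxSpan {N : ℕ} : (1 : R) ∈ boxSpan p c N := by
  simpa using monomial_mem_boxSpan (p := p) (c := c) (N := N) (fun _ => 0) (by simp)

theorem mul_mem_boxSpan {M N : ℕ} {x y : R} (hx : x ∈ boxSpan p c M) (hy : y ∈ boxSpan p c N) :
    x * y ∈ boxSpan p c (M + N) := by
  have h := Submodule.mul_mem_mul hx hy
  rw [boxSpan, boxSpan, Submodule.span_mul_span] at h
  refine Submodule.span_le.2 ?_ h
  rintro _ ⟨_, ⟨β, rfl⟩, _, ⟨γ, rfl⟩, rfl⟩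
  simp only [← Finset.prod_mul_distrib, ← pow_add]
  refine monomial_mem_boxSpan (fun i => (β i : ℕ) + γ i) fun i => ?_
  have := (β i).2
  have := (γ i).2
  omega

theorem pow_mem_boxSpan {M : ℕ} {x : R} (hx : x ∈ boxSpan p c M) (k : ℕ) :
    x ^ k ∈ boxSpan p c (k * M) := by
  induction k with
  | zero => simpa using one_mem_boxSpan
  | succ k ih => simpa [pow_succ, add_mul] using mul_mem_boxSpan ih hx

theorem prod_mem_boxSpan {ι : Type*} (S : Finset ι) (x : ι → R) (M : ℕ)
    (hx : ∀ i ∈ S, x i ∈ boxSpan p c M) : ∏ i ∈ S, x i ∈ boxSpan p c (S.card * M) := by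
  classical
  induction S using Finset.induction_on with
  | empty => simpa using one_mem_boxSpan
  | insert a S ha ih =>
    rw [Finset.prod_insert ha, Finset.card_insert_of_notMem ha, add_mul, one_mul, add_comm]
    exact mul_mem_boxSpan (hx a (by simp)) (ih fun i hi => hx i (by simp [hi]))

theorem map_boxSpan {R' : Type*} [CommRing R'] [Algebra (ZMod p) R'] (φ : R →ₐ[ZMod p] R')
    (N : ℕ) : (boxSpan p c N).map φ.toLinearMap = boxSpan p (fun i => φ (c i)) N := by
  rw [boxSpan, boxSpan, Submodule.map_span, ← Set.range_comp]
  congr 2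
  ext β
  simp

theorem aeval_mem_boxSpan {N : ℕ} (f : MvPolynomial (Fin s) (ZMod p))
    (hf : ∀ β ∈ f.support, ∀ i, β i ≤ N) : aeval c f ∈ boxSpan p c N := by
  rw [aeval_def, eval₂_eq']
  refine Submodule.sum_mem _ fun β hβ => ?_
  rw [← Algebra.smul_def]
  exact Submodule.smul_mem _ _ (monomial_mem_boxSpan _ (hf β hβ))

/-- Every element of the span of bounded monomials in `c` lifts to a polynomial with the same
bound on its monomials. -/
theorem exists_lift_boxSpan {N : ℕ} {x : R} (hx : x ∈ boxSpan p c N) :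
    ∃ f ∈ boxSpan p (X : Fin s → MvPolynomial (Fin s) (ZMod p)) N, aeval c f = x := by
  have h := map_boxSpan (p := p) (c := X) (aeval c : MvPolynomial (Fin s) (ZMod p) →ₐ[ZMod p] R) N
  simp only [aeval_X] at h
  rw [← h] at hx
  exact hx

variable [Fact p.Prime]

instance finite_boxSpan (N : ℕ) : Module.Finite (ZMod p) (boxSpan p c N) :=
  Module.Finite.span_of_finite _ (Set.finite_range _)

theorem finrank_boxSpan_le (N : ℕ) : Module.finrank (ZMod p) (boxSpan p c N) ≤ (N + 1) ^ s := by
  refine (finrank_range_le_card (R := ZMod p) _).trans ?_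
  simp

theorem natCard_boxSpan_le (N : ℕ) : Nat.card (boxSpan p c N) ≤ p ^ (N + 1) ^ s := by
  rw [Module.natCard_eq_pow_finrank (K := ZMod p), Nat.card_zmod]
  exact Nat.pow_le_pow_right (Nat.Prime.pos Fact.out) (finrank_boxSpan_le N)

instance finite_coe_boxSpan (N : ℕ) : Finite (boxSpan p c N) :=
  Module.finite_of_finite (ZMod p)

/-- Splitting the exponents of the monomials by division with remainder by `p`. -/
theorem exists_frobenius_split_boxSpan [CharP R p] {N : ℕ} {z : R} (hz : z ∈ boxSpan p c N) :
    ∃ y : (Fin s → Fin p) → R, (∀ ρ, y ρ ∈ boxSpan p c (N / p)) ∧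
      z = ∑ ρ, y ρ ^ p * ∏ i, c i ^ (ρ i : ℕ) := by
  classical
  have hp : 0 < p := Nat.Prime.pos Fact.out
  induction hz using Submodule.span_induction with
  | mem x hx =>
    obtain ⟨β, rfl⟩ := hx
    refine ⟨Pi.single (fun i => ⟨(β i : ℕ) % p, Nat.mod_lt _ hp⟩)
      (∏ i, c i ^ ((β i : ℕ) / p)), fun ρ => ?_, ?_⟩
    · by_cases h : ρ = fun i => ⟨(β i : ℕ) % p, Nat.mod_lt _ hp⟩
      · subst h
        rw [Pi.single_eq_same]
        exact monomial_mem_boxSpan _ fun i => Nat.div_le_div_right (Nat.le_of_lt_succ (β i).2)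
      · rw [Pi.single_eq_of_ne h]
        exact zero_mem _
    · rw [Finset.sum_eq_single (fun i => ⟨(β i : ℕ) % p, Nat.mod_lt _ hp⟩)]
      · simp only [Pi.single_eq_same, ← Finset.prod_pow, ← Finset.prod_mul_distrib, ← pow_mul,
          ← pow_add]
        refine Finset.prod_congr rfl fun i _ => ?_
        rw [Nat.div_add_mod']
      · intro ρ _ h
        rw [Pi.single_eq_of_ne h, zero_pow hp.ne', zero_mul]
      · simp
  | zero => exact ⟨0, by simp, by simp [hp.ne']⟩
  | add x y _ _ hx hy =>
    obtain ⟨u, hu, rfl⟩ := hx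
    obtain ⟨v, hv, rfl⟩ := hy
    refine ⟨u + v, fun ρ => add_mem (hu ρ) (hv ρ), ?_⟩
    rw [← Finset.sum_add_distrib]
    refine Finset.sum_congr rfl fun ρ _ => ?_
    rw [Pi.add_apply, add_pow_char, add_mul]
  | smul a x _ hx =>
    obtain ⟨u, hu, rfl⟩ := hx
    refine ⟨a • u, fun ρ => Submodule.smul_mem _ _ (hu ρ), ?_⟩
    rw [Finset.smul_sum]
    refine Finset.sum_congr rfl fun ρ _ => ?_
    rw [Pi.smul_apply, smul_pow, ZMod.pow_card, smul_mul_assoc]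

end BoxSpan

/-! ### Taylor expansions and the growth of the field -/

section Taylor

variable {p : ℕ} {K : Type*} [Field K] [Algebra (ZMod p) K] {s : ℕ}

/-- The derivative of the polynomial `g` at the point `c` in the direction `w`. -/
def dirDeriv (c w : Fin s → K) (g : MvPolynomial (Fin s) (ZMod p)) : K :=
  ∑ i, w i * aeval c (pderiv i g)

theorem dirDeriv_add (c w : Fin s → K) (f g : MvPolynomial (Fin s) (ZMod p)) :
    dirDeriv c w (f + g) = dirDeriv c w f + dirDeriv c w g := by
  simp [dirDeriv, mul_add, Finset.sum_add_distrib]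

theorem dirDeriv_sum {ι : Type*} (S : Finset ι) (c w : Fin s → K)
    (f : ι → MvPolynomial (Fin s) (ZMod p)) :
    dirDeriv c w (∑ i ∈ S, f i) = ∑ i ∈ S, dirDeriv c w (f i) := by
  simp only [dirDeriv, map_sum, Finset.mul_sum]
  exact Finset.sum_comm

theorem dirDeriv_mul (c w : Fin s → K) (f g : MvPolynomial (Fin s) (ZMod p)) :
    dirDeriv c w (f * g) = aeval c f * dirDeriv c w g + dirDeriv c w f * aeval c g := by
  simp only [dirDeriv, Finset.mul_sum, Finset.sum_mul, ← Finset.sum_add_distrib]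
  refine Finset.sum_congr rfl fun i _ => ?_
  rw [pderiv_mul, map_add, map_mul, map_mul]
  ring

theorem dirDeriv_C (c w : Fin s → K) (a : ZMod p) : dirDeriv c w (C a) = 0 := by
  simp [dirDeriv]

theorem dirDeriv_X (c w : Fin s → K) (i : Fin s) :
    dirDeriv c w (X i : MvPolynomial (Fin s) (ZMod p)) = w i := by
  simp [dirDeriv, pderiv_X, Pi.single_apply, Finset.sum_ite_eq]

variable {ι : Type*} [Fintype ι]

/-- The Taylor expansion `g ↦ g (c + ε ∑ z_j w_j)`, a polynomial in `ε` whose coefficients are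
polynomials in the `z_j`. -/
def taylorHom (c : Fin s → K) (w : ι → Fin s → K) :
    MvPolynomial (Fin s) (ZMod p) →ₐ[ZMod p] Polynomial (MvPolynomial ι K) :=
  aeval fun i => Polynomial.C (C (c i)) + Polynomial.C (∑ j, C (w j i) * X j) * Polynomial.X

theorem coeff_zero_taylorHom (c : Fin s → K) (w : ι → Fin s → K)
    (g : MvPolynomial (Fin s) (ZMod p)) : (taylorHom c w g).coeff 0 = C (aeval c g) := by
  induction g using MvPolynomial.induction_on with
  | C a =>
    rw [taylorHom, algHom_C, algHom_C, Polynomial.algebraMap_apply, Polynomial.coeff_C_zero,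
      MvPolynomial.algebraMap_apply]
  | add f g hf hg => simp [hf, hg]
  | mul_X f i hf =>
    rw [map_mul, Polynomial.mul_coeff_zero, hf, map_mul, map_mul]
    simp [taylorHom]

theorem coeff_one_taylorHom (c : Fin s → K) (w : ι → Fin s → K)
    (g : MvPolynomial (Fin s) (ZMod p)) :
    (taylorHom c w g).coeff 1 = ∑ j, C (dirDeriv c (w j) g) * X j := by
  induction g using MvPolynomial.induction_on with
  | C a =>
    rw [taylorHom, algHom_C, Polynomial.algebraMap_apply, Polynomial.coeff_C]
    simp [dirDeriv_C]
  | add f g hf hg => simp [hf, hg, dirDeriv_add, add_mul, Finset.sum_add_distrib]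
  | mul_X f i hf =>
    rw [map_mul, Polynomial.mul_coeff_one, hf, coeff_zero_taylorHom, coeff_zero_taylorHom]
    have h1 : (taylorHom c w (X i : MvPolynomial (Fin s) (ZMod p))).coeff 1
        = ∑ j, C (w j i) * X j := by
      simp [taylorHom]
    rw [h1, Finset.mul_sum, Finset.sum_mul, ← Finset.sum_add_distrib]
    refine Finset.sum_congr rfl fun j _ => ?_
    rw [dirDeriv_mul, dirDeriv_X, aeval_X, map_add, map_mul, map_mul]
    ring

/-- Quasi-regularity: if the `f i` vanish at `c` and have independent differentials there, then
the products `∏ i, f i ^ a i` are linearly independent over lifts of elements of `K`.  The term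
with the smallest exponent sum gives the lowest order term of the Taylor expansion. -/
theorem eq_zero_of_sum_prod_pow_mul_eq_zero [DecidableEq ι] (c : Fin s → K)
    (w : ι → Fin s → K)
    (f : ι → MvPolynomial (Fin s) (ZMod p)) (hf : ∀ i, aeval c (f i) = 0)
    (hw : ∀ i j, dirDeriv c (w j) (f i) = if i = j then 1 else 0) {N : ℕ}
    (b : (ι → Fin N) → MvPolynomial (Fin s) (ZMod p))
    (hb : ∀ a, aeval c (b a) = 0 → b a = 0)
    (h : ∑ a, (∏ i, f i ^ (a i : ℕ)) * b a = 0) (a : ι → Fin N) : b a = 0 := by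
  classical
  by_contra hne
  obtain ⟨a₀, ha₀, hmin⟩ := Finset.exists_min_image (Finset.univ.filter fun a => b a ≠ 0)
    (fun a => ∑ i, (a i : ℕ)) ⟨a, by simpa using hne⟩
  simp only [Finset.mem_filter, Finset.mem_univ, true_and] at ha₀ hmin
  set m := ∑ i, (a₀ i : ℕ) with hm
  have hfac : ∀ i, taylorHom c w (f i) = Polynomial.X * (taylorHom c w (f i)).divX := by
    intro i
    have h1 := Polynomial.X_mul_divX_add (taylorHom c w (f i))
    rw [coeff_zero_taylorHom, hf, map_zero, map_zero, add_zero] at h1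
    exact h1.symm
  have hdiv : ∀ i, (taylorHom c w (f i)).divX.coeff 0 = X i := by
    intro i
    rw [Polynomial.coeff_divX, zero_add, coeff_one_taylorHom]
    simp [hw, Finset.sum_ite_eq]
  set u : (ι → Fin N) → Polynomial (MvPolynomial ι K) := fun a =>
    (∏ i, (taylorHom c w (f i)).divX ^ (a i : ℕ)) * taylorHom c w (b a) with hu
  have hu0 : ∀ a, (u a).coeff 0 = (∏ i, X i ^ (a i : ℕ)) * C (aeval c (b a)) := by
    intro a
    rw [hu, Polynomial.mul_coeff_zero, coeff_zero_taylorHom, ← Polynomial.constantCoeff_apply,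
      map_prod]
    simp only [map_pow, Polynomial.constantCoeff_apply, hdiv]
  have hterm : ∀ a, taylorHom c w ((∏ i, f i ^ (a i : ℕ)) * b a)
      = Polynomial.X ^ m * (Polynomial.X ^ (∑ i, (a i : ℕ) - m) * u a) := by
    intro a
    by_cases hba : b a = 0
    · simp [hu, hba]
    · rw [← mul_assoc, ← pow_add, Nat.add_sub_cancel' (hmin a hba), map_mul, map_prod, hu,
        ← mul_assoc, ← Finset.prod_pow_eq_pow_sum, ← Finset.prod_mul_distrib]
      congr 1
      refine Finset.prod_congr rfl fun i _ => ?_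
      rw [map_pow, ← mul_pow, ← hfac]
  have h1 : ∑ a, Polynomial.X ^ (∑ i, (a i : ℕ) - m) * u a = 0 := by
    have h2 := congrArg (taylorHom c w) h
    rw [map_sum, map_zero] at h2
    simp only [hterm] at h2
    rw [← Finset.mul_sum] at h2
    exact (mul_eq_zero.1 h2).resolve_left (pow_ne_zero _ Polynomial.X_ne_zero)
  have h2 := congrArg (fun q => MvPolynomial.coeff
    (Finsupp.equivFunOnFinite.symm fun i => (a₀ i : ℕ)) (Polynomial.coeff q 0)) h1
  simp only [Polynomial.finsetSum_coeff, Polynomial.coeff_zero, MvPolynomial.coeff_zero,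
    MvPolynomial.coeff_sum] at h2
  have hX : ∀ a : ι → Fin N, (∏ i, X i ^ (a i : ℕ) : MvPolynomial ι K)
      = monomial (Finsupp.equivFunOnFinite.symm fun i => (a i : ℕ)) 1 := by
    intro a
    rw [monomial_eq, map_one, one_mul, Finsupp.prod_fintype _ _ (by simp)]
    rfl
  rw [Finset.sum_eq_single a₀] at h2
  · rw [← hm, Nat.sub_self, pow_zero, one_mul, hu0, hX, mul_comm, coeff_C_mul, coeff_monomial,
      if_pos rfl, mul_one] at h2
    exact ha₀ (hb _ h2)
  · intro a _ haa
    rw [Polynomial.mul_coeff_zero, hu0, hX, mul_comm (monomial _ _), mul_left_comm, coeff_C_mul]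
    by_cases hd : ∑ i, (a i : ℕ) - m = 0
    · rw [hd, pow_zero, Polynomial.coeff_one_zero, one_mul, coeff_monomial, if_neg, mul_zero]
      intro he
      refine haa (funext fun i => Fin.ext ?_)
      simpa using DFunLike.congr_fun he i
    · rw [Polynomial.coeff_X_pow, if_neg (Ne.symm hd), zero_mul, MvPolynomial.coeff_zero,
        mul_zero]
  · simp

/-- The growth of the spaces of bounded monomials is bounded by the number of equations with
independent differentials. -/
theorem pow_mul_finrank_boxSpan_le [Fact p.Prime] [DecidableEq ι] (c : Fin s → K)
    (w : ι → Fin s → K)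
    (f : ι → MvPolynomial (Fin s) (ZMod p)) (hf : ∀ i, aeval c (f i) = 0)
    (hw : ∀ i j, dirDeriv c (w j) (f i) = if i = j then 1 else 0) {δ : ℕ}
    (hδ : ∀ i, f i ∈ boxSpan p X δ) (N : ℕ) :
    (N + 1) ^ Fintype.card ι * Module.finrank (ZMod p) (boxSpan p c N)
      ≤ (Fintype.card ι * (N * δ) + N + 1) ^ s := by
  classical
  -- a linear choice of lifts
  obtain ⟨σ, hσ⟩ : ∃ σ : boxSpan p c N →ₗ[ZMod p] MvPolynomial (Fin s) (ZMod p),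
      ∀ x, σ x ∈ boxSpan p X N ∧ aeval c (σ x) = (x : K) := by
    let π : boxSpan p (X : Fin s → MvPolynomial (Fin s) (ZMod p)) N →ₗ[ZMod p] boxSpan p c N :=
      (aeval c : MvPolynomial (Fin s) (ZMod p) →ₐ[ZMod p] K).toLinearMap.restrict fun g hg => by
        have h1 := Submodule.mem_map_of_mem
          (f := (aeval c : MvPolynomial (Fin s) (ZMod p) →ₐ[ZMod p] K).toLinearMap) hg
        rw [map_boxSpan] at h1
        simpa using h1
    have hπ : Function.Surjective π := by
      rintro ⟨x, hx⟩
      obtain ⟨g, hg, rfl⟩ := exists_lift_boxSpan hx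
      exact ⟨⟨g, hg⟩, rfl⟩
    obtain ⟨τ, hτ⟩ := π.exists_rightInverse_of_surjective (LinearMap.range_eq_top.2 hπ)
    refine ⟨(Submodule.subtype _).comp τ, fun x => ⟨(τ x).2, ?_⟩⟩
    have := congrArg Subtype.val (LinearMap.congr_fun hτ x)
    exact this
  let Φ : ((ι → Fin (N + 1)) → boxSpan p c N) →ₗ[ZMod p] MvPolynomial (Fin s) (ZMod p) :=
    ∑ a, (LinearMap.mulLeft (ZMod p) (∏ i, f i ^ (a i : ℕ))).comp (σ.comp (LinearMap.proj a))
  have hΦ : ∀ x, Φ x = ∑ a, (∏ i, f i ^ (a i : ℕ)) * σ (x a) := by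
    intro x
    simp [Φ]
  have hmem : ∀ x, Φ x ∈ boxSpan p X (Fintype.card ι * (N * δ) + N) := by
    intro x
    rw [hΦ]
    refine Submodule.sum_mem _ fun a _ => mul_mem_boxSpan ?_ (hσ _).1
    refine prod_mem_boxSpan _ _ _ fun i _ => ?_
    exact boxSpan_mono (Nat.mul_le_mul_right _ (Nat.le_of_lt_succ (a i).2))
      (pow_mem_boxSpan (hδ i) _)
  have hinj : Function.Injective (Φ.codRestrict _ hmem) := by
    rw [← LinearMap.ker_eq_bot, LinearMap.ker_codRestrict, LinearMap.ker_eq_bot']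
    intro x hx
    rw [hΦ] at hx
    funext a
    have h1 := eq_zero_of_sum_prod_pow_mul_eq_zero c w f hf hw (fun a => σ (x a)) (fun a ha => by
      rw [(hσ _).2] at ha
      have : x a = 0 := Subtype.ext ha
      simp [this]) hx a
    have h2 := (hσ (x a)).2
    rw [h1, map_zero] at h2
    exact Subtype.ext h2.symm
  have h1 := LinearMap.finrank_le_finrank_of_injective hinj
  rw [Module.finrank_pi_fintype, Finset.sum_const, Finset.card_univ, Fintype.card_fun,
    Fintype.card_fin, smul_eq_mul] at h1
  exact h1.trans (finrank_boxSpan_le _)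

end Taylor

/-! ### Equations, tangent vectors and independence over `K ^ p` -/

section FrobeniusBasis

variable {p : ℕ} {K : Type*} [Field K] [Algebra (ZMod p) K] {s : ℕ}

theorem dirDeriv_pow (c w : Fin s → K) (f : MvPolynomial (Fin s) (ZMod p)) (k : ℕ) :
    dirDeriv c w (f ^ k) = k * aeval c f ^ (k - 1) * dirDeriv c w f := by
  simp only [dirDeriv, Finset.mul_sum]
  refine Finset.sum_congr rfl fun i _ => ?_
  rw [pderiv_pow]
  simp only [map_mul, map_pow, map_natCast]
  ring

variable {β : Type*} [Fintype β] [DecidableEq β]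

/-- Euler's formula: the operator `t_j ∂/∂t_j` multiplies a monomial by its exponent at `j`. -/
theorem mul_dirDeriv_prod_pow (c : Fin s → K) (e : β → Fin s) (v : β → Fin s → K)
    (hv : ∀ i j, v i (e j) = if i = j then 1 else 0) (a : β → ℕ) (j : β) :
    c (e j) * dirDeriv c (v j) (∏ i, (X (e i) : MvPolynomial (Fin s) (ZMod p)) ^ a i)
      = a j * ∏ i, c (e i) ^ a i := by
  suffices h : ∀ S : Finset β, c (e j) * dirDeriv c (v j)
      (∏ i ∈ S, (X (e i) : MvPolynomial (Fin s) (ZMod p)) ^ a i)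
      = (if j ∈ S then (a j : K) else 0) * ∏ i ∈ S, c (e i) ^ a i by
    simpa using h Finset.univ
  intro S
  induction S using Finset.induction_on with
  | empty => simpa using Or.inr (dirDeriv_C (p := p) c (v j) 1)
  | insert k S hk ih =>
    rw [Finset.prod_insert hk, Finset.prod_insert hk, dirDeriv_mul, mul_add, mul_left_comm, ih,
      dirDeriv_pow, dirDeriv_X, hv]
    simp only [map_prod, map_pow, aeval_X]
    by_cases hjk : j = k
    · subst hjk
      rw [if_neg hk, if_pos rfl, if_pos (Finset.mem_insert_self _ _)]
      rcases Nat.eq_zero_or_pos (a j) with h0 | h0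
      · simp [h0]
      · obtain ⟨m, hm⟩ := Nat.exists_eq_succ_of_ne_zero h0.ne'
        rw [hm, Nat.succ_sub_one, pow_succ]
        ring
    · rw [if_neg hjk]
      simp only [Finset.mem_insert, hjk, false_or]
      ring

variable [Fact p.Prime]

/-- If the coordinates `c (e j)` have a dual system of tangent vectors at the point `c`, then the
monomials in them with exponents less than `p` are linearly independent over `K ^ p`.  The
operators `t_j ∂/∂t_j` are linear over `K ^ p` and have these monomials as eigenvectors with
distinct systems of eigenvalues. -/
theorem eq_zero_of_sum_pow_mul_monomial_eq_zero (c : Fin s → K)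
    (hgen : ∀ x : K, ∃ g h : MvPolynomial (Fin s) (ZMod p), x = aeval c g / aeval c h)
    (e : β → Fin s) (v : β → Fin s → K)
    (hv : ∀ i j, v i (e j) = if i = j then 1 else 0)
    (hker : ∀ i (g : MvPolynomial (Fin s) (ZMod p)), aeval c g = 0 → dirDeriv c (v i) g = 0)
    (ν : (β → Fin p) → K) (h : ∑ a, ν a ^ p * ∏ j, c (e j) ^ (a j : ℕ) = 0) (a : β → Fin p) :
    ν a = 0 := by
  classical
  have : CharP K p := charP_of_injective_algebraMap (algebraMap (ZMod p) K).injective p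
  have key : ∀ g : (β → Fin p) → MvPolynomial (Fin s) (ZMod p),
      ∑ a, aeval c (g a) ^ p * ∏ j, c (e j) ^ (a j : ℕ) = 0 → ∀ a, aeval c (g a) = 0 := by
    intro g hg a
    have hφ : ∀ φ : MvPolynomial β (ZMod p),
        ∑ a : β → Fin p, algebraMap (ZMod p) K (eval (fun j => ((a j : ℕ) : ZMod p)) φ) *
          (aeval c (g a) ^ p * ∏ j, c (e j) ^ (a j : ℕ)) = 0 := by
      intro φ
      induction φ using MvPolynomial.induction_on with
      | C x => simp only [eval_C, ← Finset.mul_sum, hg, mul_zero]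
      | add f g hf hg =>
        simp only [map_add, add_mul, Finset.sum_add_distrib, hf, hg, add_zero]
      | mul_X f j hf =>
        have h1 := hker j (∑ a : β → Fin p, C (eval (fun j => ((a j : ℕ) : ZMod p)) f) *
          (g a ^ p * ∏ j, X (e j) ^ (a j : ℕ))) (by
            rw [← hf]
            simp only [map_sum, map_mul, map_pow, map_prod, aeval_X, aeval_C])
        rw [dirDeriv_sum] at h1
        have h2 := congrArg (c (e j) * ·) h1
        simp only [mul_zero, Finset.mul_sum] at h2
        rw [← h2]
        refine Finset.sum_congr rfl fun a _ => ?_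
        have h3 := mul_dirDeriv_prod_pow (p := p) c e v hv (fun i => (a i : ℕ)) j
        rw [dirDeriv_mul, dirDeriv_C, zero_mul, add_zero, dirDeriv_mul, dirDeriv_pow,
          CharP.cast_eq_zero K p, zero_mul, zero_mul, zero_mul, add_zero, aeval_C, map_pow,
          map_mul, eval_X, map_mul, map_natCast]
        linear_combination -(algebraMap (ZMod p) K (eval (fun j => ((a j : ℕ) : ZMod p)) f) *
          aeval c (g a) ^ p) * h3
    have h1 := hφ (indicator fun j => ((a j : ℕ) : ZMod p))
    rw [Finset.sum_eq_single a] at h1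
    · rw [eval_indicator_apply_eq_one, map_one, one_mul] at h1
      by_cases hc : ∀ j : β, (a j : ℕ) = 0 ∨ c (e j) ≠ 0
      · have h2 : ∏ j, c (e j) ^ (a j : ℕ) ≠ 0 := Finset.prod_ne_zero_iff.2 fun j _ => by
          rcases hc j with h | h
          · simp [h]
          · exact pow_ne_zero _ h
        exact eq_zero_of_pow_eq_zero ((mul_eq_zero.1 h1).resolve_right h2)
      · push Not at hc
        obtain ⟨j, -, hj⟩ := hc
        have h3 := hker j (X (e j)) (by rw [aeval_X, hj])
        rw [dirDeriv_X, hv, if_pos rfl] at h3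
        exact absurd h3 one_ne_zero
    · intro b _ hb
      rw [eval_indicator_apply_eq_zero, map_zero, zero_mul]
      intro hab
      refine hb (funext fun j => Fin.ext ?_)
      have h3 := congrFun hab j
      rw [ZMod.natCast_eq_natCast_iff] at h3
      exact Nat.ModEq.eq_of_lt_of_lt h3 (b j).2 (a j).2
    · simp
  have hgen' : ∀ x : K, ∃ g h : MvPolynomial (Fin s) (ZMod p),
      aeval c h ≠ 0 ∧ x * aeval c h = aeval c g := by
    intro x
    obtain ⟨g, h, hx⟩ := hgen x
    by_cases h0 : aeval c h = 0
    · exact ⟨0, 1, by simp, by simp [hx, h0]⟩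
    · exact ⟨g, h, h0, by rw [hx, div_mul_cancel₀ _ h0]⟩
  choose g d hd hg using fun a => hgen' (ν a)
  have h0 : (∏ b, aeval c (d b)) ≠ 0 := Finset.prod_ne_zero_iff.2 fun b _ => hd b
  have h1 : ∀ a, aeval c (g a * ∏ b ∈ Finset.univ.erase a, d b) = ν a * ∏ b, aeval c (d b) := by
    intro a
    rw [map_mul, ← hg, map_prod, mul_assoc,
      Finset.mul_prod_erase Finset.univ (fun b => aeval c (d b)) (Finset.mem_univ a)]
  have h2 := key (fun a => g a * ∏ b ∈ Finset.univ.erase a, d b) (by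
    simp only [h1, mul_pow]
    rw [← mul_zero ((∏ b, aeval c (d b)) ^ p), ← h, Finset.mul_sum]
    exact Finset.sum_congr rfl fun a _ => by ring) a
  rw [h1] at h2
  exact (mul_eq_zero.1 h2).resolve_right h0

/-- A set of equations for the point `c` splits the coordinates: there are equations with
independent differentials and complementary coordinates, together with the dual basis. -/
theorem exists_jacobian_splitting (c : Fin s → K) (Rel : Set (MvPolynomial (Fin s) (ZMod p)))
    (hrel : RingHom.ker (aeval c : MvPolynomial (Fin s) (ZMod p) →ₐ[ZMod p] K) = Ideal.span Rel) :
    ∃ (ι β : Type) (_ : Fintype ι) (_ : Fintype β) (f : ι → Rel) (w : ι → Fin s → K)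
      (e : β → Fin s) (v : β → Fin s → K), Fintype.card ι + Fintype.card β = s ∧
      (∀ i j : ι, dirDeriv c (w j) (f i : MvPolynomial (Fin s) (ZMod p)) =
        by classical exact if i = j then 1 else 0) ∧
      (∀ i j : β, v i (e j) = by classical exact if i = j then 1 else 0) ∧
      ∀ i (g : MvPolynomial (Fin s) (ZMod p)), aeval c g = 0 → dirDeriv c (v i) g = 0 := by
  classical
  let u : Rel ⊕ Fin s → Fin s → K :=
    Sum.elim (fun f i => aeval c (pderiv i (f : MvPolynomial (Fin s) (ZMod p))))
      fun i => Pi.single i 1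
  obtain ⟨b₁, hb₁, -, hspan₁, hli₁⟩ := exists_linearIndepOn_extension
    (linearIndepOn_empty K u) (Set.empty_subset (Set.range Sum.inl))
  obtain ⟨b, -, hb, hspan, hli⟩ := exists_linearIndepOn_extension hli₁ (Set.subset_univ b₁)
  have htop : ⊤ ≤ Submodule.span K (Set.range fun x : b => u x) := by
    rw [← (Pi.basisFun K (Fin s)).span_eq, Submodule.span_le]
    rintro _ ⟨i, rfl⟩
    have h1 := hspan ⟨Sum.inr i, trivial, rfl⟩
    rw [Set.image_eq_range] at h1
    simpa [u] using h1
  let B : Module.Basis b K (Fin s → K) := Module.Basis.mk hli htop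
  have hB : ∀ x : b, B x = u x := fun x => Module.Basis.mk_apply hli htop x
  have : Fintype b := FiniteDimensional.fintypeBasisIndex B
  let W : b → Fin s → K := fun x i => B.coord x (Pi.single i 1)
  have hW : ∀ (x : b) (y : Fin s → K), ∑ i, W x i * y i = B.coord x y := by
    intro x y
    conv_rhs => rw [pi_eq_sum_univ' y, map_sum]
    refine Finset.sum_congr rfl fun i _ => ?_
    rw [map_smul, smul_eq_mul, mul_comm]
  have hWd : ∀ (x : b) (f : Rel), dirDeriv c (W x) (f : MvPolynomial (Fin s) (ZMod p))
      = B.coord x (u (Sum.inl f)) := fun x f => hW x _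
  have eq := Equiv.subtypeSum (p := fun x => x ∈ b)
  have : Fintype {f : Rel // Sum.inl f ∈ b} :=
    Fintype.ofInjective (fun f => (⟨Sum.inl f.1, f.2⟩ : b)) fun f g h => by
      simpa [Subtype.ext_iff] using h
  refine ⟨{f : Rel // Sum.inl f ∈ b}, {i : Fin s // Sum.inr i ∈ b}, inferInstance, inferInstance,
    fun f => f.1, fun f => W ⟨_, f.2⟩, fun i => i.1, fun i => W ⟨_, i.2⟩, ?_, ?_, ?_, ?_⟩
  · rw [← Fintype.card_sum, ← Fintype.card_congr eq]
    have h1 := Module.finrank_eq_card_basis B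
    rw [Module.finrank_fintype_fun_eq_card, Fintype.card_fin] at h1
    convert h1.symm
  · intro f g
    rw [hWd, ← hB ⟨Sum.inl f.1, f.2⟩, Module.Basis.coord_apply, Module.Basis.repr_self,
      Finsupp.single_apply]
    simp [Subtype.ext_iff]
  · intro i j
    change B.coord _ (u (Sum.inr j.1)) = _
    rw [← hB ⟨Sum.inr j.1, j.2⟩, Module.Basis.coord_apply, Module.Basis.repr_self,
      Finsupp.single_apply]
    simp [Subtype.ext_iff, eq_comm]
  · intro i g hg
    have hgens : ∀ f : Rel, dirDeriv c (W ⟨_, i.2⟩) (f : MvPolynomial (Fin s) (ZMod p)) = 0 := by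
      intro f
      rw [hWd]
      have h1 := hspan₁ ⟨Sum.inl f, ⟨f, rfl⟩, rfl⟩
      have h2 : Submodule.span K (u '' b₁) ≤ LinearMap.ker (B.coord ⟨_, i.2⟩) := by
        rw [Submodule.span_le]
        rintro _ ⟨x, hx, rfl⟩
        obtain ⟨f', rfl⟩ := hb₁ hx
        rw [SetLike.mem_coe, LinearMap.mem_ker, ← hB ⟨Sum.inl f', hb hx⟩,
          Module.Basis.coord_apply, Module.Basis.repr_self, Finsupp.single_apply, if_neg]
        simp
      exact h2 h1
    have hg' : g ∈ Ideal.span Rel := by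
      rw [← hrel]
      exact hg
    clear hg
    have hvan : ∀ f ∈ Ideal.span Rel, aeval c f = 0 := by
      intro f hf
      rw [← hrel] at hf
      exact hf
    induction hg' using Submodule.span_induction with
    | mem f hf => exact hgens ⟨f, hf⟩
    | zero => simpa using dirDeriv_C c _ (0 : ZMod p)
    | add f g hf hg ihf ihg => rw [dirDeriv_add, ihf, ihg, add_zero]
    | smul x f hf ih =>
      rw [smul_eq_mul, dirDeriv_mul, ih, hvan f hf, mul_zero, mul_zero, add_zero]

end FrobeniusBasis

/-! ### A basis of `K` over `K ^ p` with bounded structure constants -/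

/-- A function of growth at most `E (N + 1) ^ b` cannot grow by a factor `1 + p ^ b` whenever its
argument is multiplied by `p`. -/
theorem exists_lt_one_add_pow_mul {p : ℕ} (hp : 2 ≤ p) (H : ℕ → ℕ) (E b : ℕ) (h0 : 1 ≤ H 0)
    (hH : ∀ N, H N ≤ E * (N + 1) ^ b) :
    ∃ N ≤ p ^ (E * p ^ b), H (p * N + (p - 1)) < (1 + p ^ b) * H N := by
  by_contra! hcon
  have hE : 1 ≤ E := by simpa using h0.trans (hH 0)
  set x := p ^ b with hx
  have hx1 : 1 ≤ x := Nat.one_le_pow _ _ (by omega)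
  set n := E * x with hn
  have hlow : ∀ j ≤ n, (1 + x) ^ j ≤ H (p ^ j - 1) := by
    intro j hj
    induction j with
    | zero => simpa using h0
    | succ j ih =>
      have h1 := hcon (p ^ j - 1) ((Nat.sub_le _ _).trans (Nat.pow_le_pow_right (by omega)
        (by omega)))
      have h2 : p * (p ^ j - 1) + (p - 1) = p ^ (j + 1) - 1 := by
        have h3 : 1 ≤ p ^ j := Nat.one_le_pow _ _ (by omega)
        have h4 : p ≤ p * p ^ j := Nat.le_mul_of_pos_right _ h3
        rw [Nat.mul_sub, mul_one, pow_succ, mul_comm (p ^ j) p]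
        omega
      rw [h2] at h1
      calc (1 + x) ^ (j + 1) = (1 + x) * (1 + x) ^ j := pow_succ' _ _
        _ ≤ (1 + x) * H (p ^ j - 1) := Nat.mul_le_mul_left _ (ih (by omega))
        _ ≤ _ := h1
  have hbern : ∀ j, x ^ j * (x + j) ≤ x * (1 + x) ^ j := by
    intro j
    induction j with
    | zero => simp
    | succ j ih =>
      calc x ^ (j + 1) * (x + (j + 1)) ≤ x ^ j * (x + j) * (1 + x) := by
            rw [pow_succ, mul_assoc, mul_assoc]
            exact Nat.mul_le_mul_left _ (by nlinarith)
        _ ≤ x * (1 + x) ^ j * (1 + x) := Nat.mul_le_mul_right _ ih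
        _ = _ := by ring
  have h1 := hlow n le_rfl
  have h2 := hH (p ^ n - 1)
  rw [Nat.sub_add_cancel (Nat.one_le_pow _ _ (by omega)), pow_right_comm,
    ← hx] at h2
  have h3 := hbern n
  have h4 : x ^ n * (x + n) ≤ x ^ n * n := by
    calc x ^ n * (x + n) ≤ x * (E * x ^ n) := h3.trans (Nat.mul_le_mul_left _ (h1.trans h2))
      _ = x ^ n * n := by rw [hn]; ring
  have h5 := Nat.le_of_mul_le_mul_left h4 (Nat.pow_pos hx1)
  omega

section Siegel

variable {p : ℕ} [Fact p.Prime] {K : Type*} [Field K] [Algebra (ZMod p) K] {s : ℕ}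

/-- The `p`-th power map as a linear map over the prime field. -/
def frobeniusLinear (p : ℕ) [Fact p.Prime] (K : Type*) [Field K] [Algebra (ZMod p) K] :
    K →ₗ[ZMod p] K where
  toFun x := x ^ p
  map_add' x y := by
    have : CharP K p := charP_of_injective_algebraMap (algebraMap (ZMod p) K).injective p
    exact add_pow_char x y p
  map_smul' a x := by rw [smul_pow, ZMod.pow_card, RingHom.id_apply]

theorem frobeniusLinear_apply (x : K) : frobeniusLinear p K x = x ^ p := rfl

/-- A counting argument: if there are more unknowns than equations, an element of small size is a
quotient of small combinations of a family that is linearly independent over `K ^ p`. -/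
theorem exists_pow_mul_eq_sum {J : Type*} [Fintype J] (c : Fin s → K) (m : J → K)
    (hm : ∀ ν : J → K, ∑ j, ν j ^ p * m j = 0 → ν = 0) {N : ℕ}
    (hmN : ∀ j, m j ∈ boxSpan p c (p - 1))
    (hN : Module.finrank (ZMod p) (boxSpan p c (p * N + (p - 1)))
      < (1 + Fintype.card J) * Module.finrank (ZMod p) (boxSpan p c N))
    (y : K) (hy : y ∈ boxSpan p c (p - 1)) :
    ∃ D ∈ boxSpan p c N, D ≠ 0 ∧ ∃ ν : J → K, (∀ j, ν j ∈ boxSpan p c N) ∧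
      D ^ p * y = ∑ j, ν j ^ p * m j := by
  let m' : Option J → K := fun o => o.elim (-y) m
  let Φ : (Option J → boxSpan p c N) →ₗ[ZMod p] K :=
    ∑ o, (LinearMap.mulRight (ZMod p) (m' o)).comp ((frobeniusLinear p K).comp
      ((Submodule.subtype _).comp (LinearMap.proj o)))
  have hΦ : ∀ x, Φ x = ∑ o, (x o : K) ^ p * m' o := by
    intro x
    simp [Φ, frobeniusLinear_apply]
  have hmem : ∀ x, Φ x ∈ boxSpan p c (p * N + (p - 1)) := by
    intro x
    rw [hΦ]
    refine Submodule.sum_mem _ fun o _ => mul_mem_boxSpan (pow_mem_boxSpan (x o).2 p) ?_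
    cases o with
    | none => exact neg_mem hy
    | some j => exact hmN j
  have hninj : ¬ Function.Injective (Φ.codRestrict _ hmem) := by
    intro hinj
    have h1 := LinearMap.finrank_le_finrank_of_injective hinj
    rw [Module.finrank_pi_fintype, Finset.sum_const, Finset.card_univ, Fintype.card_option,
      smul_eq_mul, add_comm] at h1
    omega
  rw [← LinearMap.ker_eq_bot, LinearMap.ker_codRestrict, LinearMap.ker_eq_bot'] at hninj
  push Not at hninj
  obtain ⟨x, hx, hx0⟩ := hninj
  rw [hΦ, Fintype.sum_option] at hx
  simp only [m', Option.elim] at hx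
  refine ⟨x none, (x none).2, fun h0 => hx0 ?_, fun j => x (some j), fun j => (x (some j)).2, ?_⟩
  · rw [h0, zero_pow (Nat.Prime.pos Fact.out).ne', zero_mul, zero_add] at hx
    have h1 := hm _ hx
    funext o
    cases o with
    | none => exact Subtype.ext h0
    | some j => exact Subtype.ext (congrFun h1 j)
  · linear_combination -hx

/-- Bound for the size of the structure constants of `K` over `K ^ p`. -/
def structureBound (p s δ : ℕ) : ℕ := p ^ s * p ^ ((s * δ + 1) ^ s * p ^ s)

/-- A field presented by equations of degree at most `δ` has a basis over `K ^ p` with structure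
constants of bounded size and common denominator `D`. -/
theorem exists_frobenius_basis (c : Fin s → K)
    (hgen : ∀ x : K, ∃ g h : MvPolynomial (Fin s) (ZMod p), x = aeval c g / aeval c h)
    (Rel : Set (MvPolynomial (Fin s) (ZMod p)))
    (hrel : RingHom.ker (aeval c : MvPolynomial (Fin s) (ZMod p) →ₐ[ZMod p] K) = Ideal.span Rel)
    {δ : ℕ} (hδ : ∀ f ∈ Rel, f ∈ boxSpan p X δ) :
    ∃ (J : Type) (_ : Fintype J) (m : J → K) (D : K), D ≠ 0 ∧
      D ∈ boxSpan p c (structureBound p s δ) ∧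
      (∀ ν : J → K, ∑ j, ν j ^ p * m j = 0 → ν = 0) ∧
      ∀ ρ : Fin s → Fin p, ∃ ν : J → K, (∀ j, ν j ∈ boxSpan p c (structureBound p s δ)) ∧
        D ^ p * ∏ i, c i ^ (ρ i : ℕ) = ∑ j, ν j ^ p * m j := by
  classical
  have hp : p.Prime := Fact.out
  obtain ⟨ι, β, _, _, f, w, e, v, hcard, hw, hv, hker⟩ := exists_jacobian_splitting c Rel hrel
  set E := (s * δ + 1) ^ s with hE
  have hH : ∀ N, Module.finrank (ZMod p) (boxSpan p c N) ≤ E * (N + 1) ^ Fintype.card β := by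
    intro N
    have h1 := pow_mul_finrank_boxSpan_le c w (fun i => (f i : MvPolynomial (Fin s) (ZMod p)))
      (fun i => by
        have h2 : (f i : MvPolynomial (Fin s) (ZMod p)) ∈ Ideal.span Rel :=
          Ideal.subset_span (f i).2
        rw [← hrel] at h2
        exact h2) (fun i j => by convert hw i j) (fun i => hδ _ (f i).2) N
    have h2 : (Fintype.card ι * (N * δ) + N + 1) ^ s
        ≤ (N + 1) ^ Fintype.card ι * (E * (N + 1) ^ Fintype.card β) := by
      have h3 : Fintype.card ι * (N * δ) + N + 1 ≤ (s * δ + 1) * (N + 1) := by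
        have h4 : Fintype.card ι * (N * δ) ≤ s * (N * δ) := Nat.mul_le_mul_right _ (by omega)
        nlinarith [Nat.zero_le (s * δ)]
      calc _ ≤ ((s * δ + 1) * (N + 1)) ^ s := Nat.pow_le_pow_left h3 s
        _ = E * (N + 1) ^ (Fintype.card ι + Fintype.card β) := by rw [mul_pow, hcard]
        _ = _ := by rw [pow_add]; ring
    exact Nat.le_of_mul_le_mul_left (h1.trans h2) (by positivity)
  have h0 : 1 ≤ Module.finrank (ZMod p) (boxSpan p c 0) := by
    rw [Nat.one_le_iff_ne_zero, Ne, Submodule.finrank_eq_zero]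
    intro hbot
    have h1 : (1 : K) ∈ boxSpan p c 0 := one_mem_boxSpan
    rw [hbot, Submodule.mem_bot] at h1
    exact one_ne_zero h1
  obtain ⟨N, hN, hlt⟩ := exists_lt_one_add_pow_mul hp.two_le
    (fun N => Module.finrank (ZMod p) (boxSpan p c N)) E (Fintype.card β) h0 hH
  have hN' : N ≤ p ^ (E * p ^ s) := hN.trans (Nat.pow_le_pow_right hp.pos
    (Nat.mul_le_mul_left _ (Nat.pow_le_pow_right hp.pos (by omega))))
  have hind := eq_zero_of_sum_pow_mul_monomial_eq_zero c hgen e v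
    (fun i j => by convert hv i j) hker
  have hm : ∀ ν : (β → Fin p) → K, ∑ a, ν a ^ p * ∏ j, c (e j) ^ (a j : ℕ) = 0 → ν = 0 :=
    fun ν h => funext fun a => hind ν h a
  have he : Function.Injective e := by
    intro i j hij
    by_contra hne
    have h1 := hv i j
    have h2 := hv i i
    rw [if_neg hne] at h1
    rw [if_pos rfl, hij, h1] at h2
    exact zero_ne_one h2
  have hbox : ∀ a : β → Fin p, ∏ j, c (e j) ^ (a j : ℕ) ∈ boxSpan p c (p - 1) := by
    intro a
    have h1 : ∏ j, c (e j) ^ (a j : ℕ)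
        = ∏ i, c i ^ (Function.extend e (fun j => (a j : ℕ)) 0 i) := by
      rw [← Finset.prod_subset (Finset.subset_univ (Finset.univ.image e)),
        Finset.prod_image fun x _ y _ h => he h]
      · exact Finset.prod_congr rfl fun j _ => by rw [he.extend_apply]
      · intro i _ hi
        rw [Function.extend_apply', Pi.zero_apply, pow_zero]
        rintro ⟨j, rfl⟩
        simp at hi
    rw [h1]
    refine monomial_mem_boxSpan _ fun i => ?_
    by_cases hi : ∃ j, e j = i
    · obtain ⟨j, rfl⟩ := hi
      rw [he.extend_apply]
      exact Nat.le_sub_one_of_lt (a j).2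
    · rw [Function.extend_apply' _ _ _ hi]
      exact Nat.zero_le _
  have hsieg := fun ρ : Fin s → Fin p =>
    exists_pow_mul_eq_sum c _ hm hbox (by simpa using hlt) (∏ i, c i ^ (ρ i : ℕ))
      (monomial_mem_boxSpan _ fun i => Nat.le_sub_one_of_lt (ρ i).2)
  choose D hDN hD0 ν hνN hν using hsieg
  have hcardρ : Fintype.card (Fin s → Fin p) = p ^ s := by simp
  refine ⟨β → Fin p, inferInstance, fun a => ∏ j, c (e j) ^ (a j : ℕ), ∏ ρ, D ρ,
    Finset.prod_ne_zero_iff.2 fun ρ _ => hD0 ρ, ?_, hm, fun ρ =>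
    ⟨fun a => (∏ ρ' ∈ Finset.univ.erase ρ, D ρ') * ν ρ a, fun a => ?_, ?_⟩⟩
  · have h1 := prod_mem_boxSpan Finset.univ D N fun ρ _ => hDN ρ
    rw [Finset.card_univ, hcardρ] at h1
    exact boxSpan_mono (Nat.mul_le_mul_left _ hN') h1
  · have h1 := prod_mem_boxSpan (Finset.univ.erase ρ) D N fun ρ _ => hDN ρ
    rw [Finset.card_erase_of_mem (Finset.mem_univ _), Finset.card_univ, hcardρ] at h1
    refine boxSpan_mono ?_ (mul_mem_boxSpan h1 (hνN ρ a))
    have h2 : 1 ≤ p ^ s := Nat.one_le_pow _ _ hp.pos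
    calc (p ^ s - 1) * N + N = p ^ s * N := by
          rw [← Nat.succ_mul, Nat.succ_eq_add_one, Nat.sub_add_cancel h2]
      _ ≤ _ := Nat.mul_le_mul_left _ hN'
  · rw [← Finset.mul_prod_erase Finset.univ D (Finset.mem_univ ρ), mul_pow, mul_right_comm, hν,
      Finset.sum_mul]
    exact Finset.sum_congr rfl fun a _ => by ring

end Siegel

/-! ### Extraction of `p`-th roots from linear equations -/

section Descent

variable {p : ℕ} [Fact p.Prime] {K : Type*} [Field K] [Algebra (ZMod p) K] {s : ℕ}
  {c : Fin s → K} {J : Type*} [Fintype J] {m : J → K} {D : K} {N : ℕ}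

/-- Extracting `p`-th roots of the coordinates with respect to the basis `m` of `K` over `K ^ p`
divides the size by `p`, up to a constant, and does not enlarge the denominator `D ^ 2`. -/
theorem exists_eq_sum_pow_mul (hD0 : D ≠ 0) (hDN : D ∈ boxSpan p c N)
    (hstr : ∀ ρ : Fin s → Fin p, ∃ ν : J → K, (∀ j, ν j ∈ boxSpan p c N) ∧
        D ^ p * ∏ i, c i ^ (ρ i : ℕ) = ∑ j, ν j ^ p * m j)
    {H : ℕ} {z : K} (hz : D ^ 2 * z ∈ boxSpan p c H) :
    ∃ w : J → K, z = ∑ j, w j ^ p * m j ∧ ∀ j, D ^ 2 * w j ∈ boxSpan p c (H / p + 2 * N) := by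
  classical
  have hp : p.Prime := Fact.out
  have : CharP K p := charP_of_injective_algebraMap (algebraMap (ZMod p) K).injective p
  choose ν hνN hν using hstr
  have h1 : D ^ (p - 2) * (D ^ 2 * z) ∈ boxSpan p c (H + p * N) := by
    refine boxSpan_mono ?_ (mul_mem_boxSpan (pow_mem_boxSpan hDN (p - 2)) hz)
    rw [add_comm]
    exact Nat.add_le_add_left (Nat.mul_le_mul_right _ (Nat.sub_le _ _)) _
  obtain ⟨y, hy, hyz⟩ := exists_frobenius_split_boxSpan h1
  rw [Nat.add_mul_div_left _ _ hp.pos] at hy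
  have h2 : D ^ (2 * p) * z = ∑ j, (∑ ρ, y ρ * ν ρ j) ^ p * m j := by
    calc D ^ (2 * p) * z = D ^ p * (D ^ (p - 2) * (D ^ 2 * z)) := by
          rw [two_mul, pow_add, mul_assoc]
          congr 1
          rw [← mul_assoc, ← pow_add, Nat.sub_add_cancel hp.two_le]
      _ = ∑ ρ, y ρ ^ p * (D ^ p * ∏ i, c i ^ (ρ i : ℕ)) := by
          rw [hyz, Finset.mul_sum]
          exact Finset.sum_congr rfl fun ρ _ => by ring
      _ = ∑ ρ, ∑ j, (y ρ * ν ρ j) ^ p * m j := by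
          refine Finset.sum_congr rfl fun ρ _ => ?_
          rw [hν, Finset.mul_sum]
          exact Finset.sum_congr rfl fun j _ => by ring
      _ = _ := by
          rw [Finset.sum_comm]
          refine Finset.sum_congr rfl fun j _ => ?_
          rw [sum_pow_char, Finset.sum_mul]
  refine ⟨fun j => (∑ ρ, y ρ * ν ρ j) / D ^ 2, ?_, fun j => ?_⟩
  · refine mul_left_cancel₀ (pow_ne_zero (2 * p) hD0) ?_
    rw [h2, Finset.mul_sum]
    refine Finset.sum_congr rfl fun j _ => ?_
    rw [div_pow, ← pow_mul]
    field_simp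
  · rw [mul_div_cancel₀ _ (pow_ne_zero 2 hD0)]
    refine Submodule.sum_mem _ fun ρ _ => boxSpan_mono (le_of_eq ?_)
      (mul_mem_boxSpan (hy ρ) (hνN ρ j))
    ring

/-- A linear equation in `p ^ k`-th powers over `K` is equivalent to a system of linear equations
whose size does not depend on `k`. -/
theorem exists_linear_system (hD0 : D ≠ 0) (hDN : D ∈ boxSpan p c N)
    (hm : ∀ ν : J → K, ∑ j, ν j ^ p * m j = 0 → ν = 0)
    (hstr : ∀ ρ : Fin s → Fin p, ∃ ν : J → K, (∀ j, ν j ∈ boxSpan p c N) ∧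
        D ^ p * ∏ i, c i ^ (ρ i : ℕ) = ∑ j, ν j ^ p * m j)
    {I : Type*} [Fintype I] (A k : ℕ) (a : I → K)
    (ha : ∀ α, D ^ 2 * a α ∈ boxSpan p c (A * p ^ k + 4 * N)) :
    ∃ W : Set (I → K), (∀ b ∈ W, ∀ α, D ^ 2 * b α ∈ boxSpan p c (A + 4 * N)) ∧
      ∀ y : I → K, ∑ α, a α * y α ^ p ^ k = 0 ↔ ∀ b ∈ W, ∑ α, b α * y α = 0 := by
  have hp : p.Prime := Fact.out
  have : CharP K p := charP_of_injective_algebraMap (algebraMap (ZMod p) K).injective p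
  induction k generalizing a with
  | zero => exact ⟨{a}, by simpa using ha, by simp⟩
  | succ k ih =>
    choose w hw hwN using fun α => exists_eq_sum_pow_mul hD0 hDN hstr (ha α)
    have hsize : (A * p ^ (k + 1) + 4 * N) / p + 2 * N ≤ A * p ^ k + 4 * N := by
      have h1 : (A * p ^ (k + 1) + 4 * N) / p ≤ A * p ^ k + 2 * N := by
        refine Nat.div_le_of_le_mul ?_
        rw [pow_succ]
        nlinarith [hp.two_le, Nat.zero_le N]
      omega
    choose W hWN hW using fun j => ih (fun α => w α j) fun α => boxSpan_mono hsize (hwN α j)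
    refine ⟨⋃ j, W j, fun b hb => ?_, fun y => ?_⟩
    · obtain ⟨j, hj⟩ := Set.mem_iUnion.1 hb
      exact hWN j b hj
    · have h1 : ∑ α, a α * y α ^ p ^ (k + 1)
          = ∑ j, (∑ α, w α j * y α ^ p ^ k) ^ p * m j := by
        simp only [sum_pow_char, Finset.sum_mul]
        rw [Finset.sum_comm]
        refine Finset.sum_congr rfl fun α _ => ?_
        conv_lhs => rw [hw α, Finset.sum_mul]
        refine Finset.sum_congr rfl fun j _ => ?_
        rw [mul_pow, ← pow_mul, ← pow_succ]
        ring
      rw [h1]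
      constructor
      · intro h b hb
        obtain ⟨j, hj⟩ := Set.mem_iUnion.1 hb
        exact (hW j y).1 (congrFun (hm _ h) j) b hj
      · intro h
        refine Finset.sum_eq_zero fun j _ => ?_
        rw [(hW j y).2 fun b hb => h b (Set.mem_iUnion.2 ⟨j, hb⟩), zero_pow hp.ne_zero, zero_mul]

/-- The bound in `finite_rootSets`: the number of sets of coefficient vectors with entries in a space
of elements of bounded size. -/
def rootSetsBound (p s δ A Δ n : ℕ) : ℕ :=
  2 ^ (p ^ (A + 4 * structureBound p s δ + 1) ^ s) ^ (Δ + 1) ^ n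

/-- The sets of vectors over `K` cut out by polynomials in the `p ^ k`-th powers of the
coordinates, of bounded degree and with coefficients of size at most `A * p ^ k`. -/
def rootSets (p : ℕ) {K : Type*} [Field K] [Algebra (ZMod p) K] {s : ℕ} (c : Fin s → K)
    (A Δ n : ℕ) : Set (Set (Fin n → K)) :=
  {Z | ∃ (k : ℕ) (P : Set (MvPolynomial (Fin n) K)),
    (∀ h ∈ P, (∀ β, h.coeff β ∈ boxSpan p c (A * p ^ k)) ∧ h.totalDegree ≤ Δ) ∧
    Z = {v | ∀ h ∈ P, eval (fun i => v i ^ p ^ k) h = 0}}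

theorem finite_rootSets (c : Fin s → K)
    (hgen : ∀ x : K, ∃ g h : MvPolynomial (Fin s) (ZMod p), x = aeval c g / aeval c h)
    (Rel : Set (MvPolynomial (Fin s) (ZMod p)))
    (hrel : RingHom.ker (aeval c : MvPolynomial (Fin s) (ZMod p) →ₐ[ZMod p] K) = Ideal.span Rel)
    {δ : ℕ} (hδ : ∀ f ∈ Rel, f ∈ boxSpan p X δ) (A Δ n : ℕ) :
    (rootSets p c A Δ n).Finite ∧ (rootSets p c A Δ n).ncard ≤ rootSetsBound p s δ A Δ n := by
  classical
  obtain ⟨J, _, m, D, hD0, hDN, hm, hstr⟩ := exists_frobenius_basis c hgen Rel hrel hδ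
  set N := structureBound p s δ
  let I := Fin n → Fin (Δ + 1)
  let B := boxSpan p c (A + 4 * N)
  -- coefficient vectors with entries in `D⁻² B`
  let Θ : Set (I → B) → Set (Fin n → K) := fun W =>
    {v | ∀ b ∈ W, ∑ α, ((b α : K) / D ^ 2) * ∏ i, v i ^ (α i : ℕ) = 0}
  have hD2 : D ^ 2 ≠ 0 := pow_ne_zero 2 hD0
  have hsub : rootSets p c A Δ n ⊆ Set.range Θ := by
    rintro _ ⟨k, P, hP, rfl⟩
    have h1 : ∀ h : P, ∃ W : Set (I → K),
        (∀ b ∈ W, ∀ α, D ^ 2 * b α ∈ boxSpan p c (A + 4 * N)) ∧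
        ∀ y : I → K, ∑ α : I, (h : MvPolynomial (Fin n) K).coeff
          (Finsupp.equivFunOnFinite.symm fun i => (α i : ℕ)) * y α ^ p ^ k = 0 ↔
            ∀ b ∈ W, ∑ α, b α * y α = 0 := by
      intro h
      refine exists_linear_system hD0 hDN hm hstr A k _ fun α => ?_
      refine boxSpan_mono ?_ (mul_mem_boxSpan (pow_mem_boxSpan hDN 2) ((hP h h.2).1 _))
      omega
    choose W hWN hW using h1
    refine ⟨{b | ∃ h, (fun α => (b α : K) / D ^ 2) ∈ W h}, Set.ext fun v => ?_⟩
    have h2 : ∀ h : P, eval (fun i => v i ^ p ^ k) (h : MvPolynomial (Fin n) K)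
        = ∑ α : I, (h : MvPolynomial (Fin n) K).coeff
          (Finsupp.equivFunOnFinite.symm fun i => (α i : ℕ)) *
            (∏ i, v i ^ (α i : ℕ)) ^ p ^ k := by
      intro h
      have hinj : Function.Injective fun α : I =>
          (Finsupp.equivFunOnFinite.symm fun i => (α i : ℕ) : Fin n →₀ ℕ) := by
        intro α α' hα
        funext i
        exact Fin.ext (by simpa using DFunLike.congr_fun hα i)
      let g : I → Fin n →₀ ℕ := fun α => Finsupp.equivFunOnFinite.symm fun i => (α i : ℕ)
      have hsum := Finset.sum_image (s := Finset.univ) (g := g)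
        (f := fun β => (h : MvPolynomial (Fin n) K).coeff β * (∏ i, v i ^ β i) ^ p ^ k)
        fun x _ y _ hxy => hinj hxy
      refine Eq.trans ?_ hsum
      rw [eval_eq']
      have hpow : ∀ β : Fin n →₀ ℕ, ∏ i, (v i ^ p ^ k) ^ β i = (∏ i, v i ^ β i) ^ p ^ k := by
        intro β
        rw [← Finset.prod_pow]
        exact Finset.prod_congr rfl fun i _ => pow_right_comm _ _ _
      simp only [hpow]
      refine Finset.sum_subset ?_ ?_
      · intro β hβ
        have h3 : ∀ i, β i < Δ + 1 := fun i => by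
          have h4 := le_totalDegree hβ
          have h5 := (hP h h.2).2
          have h6 : β i ≤ β.sum fun _ e => e := by
            rw [Finsupp.sum_fintype _ _ (by simp)]
            exact Finset.single_le_sum (fun _ _ => Nat.zero_le _) (Finset.mem_univ i)
          omega
        refine Finset.mem_image.2 ⟨fun i => ⟨β i, h3 i⟩, Finset.mem_univ _, ?_⟩
        ext i
        rfl
      · intro β _ hβ
        rw [notMem_support_iff.1 hβ, zero_mul]
    constructor
    · intro hv h hP'
      rw [h2 ⟨h, hP'⟩, hW ⟨h, hP'⟩]
      intro b hb
      have h3 := hv (fun α => ⟨D ^ 2 * b α, hWN _ b hb α⟩) ⟨⟨h, hP'⟩, by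
        convert hb using 2
        rw [mul_div_cancel_left₀ _ hD2]⟩
      simpa only [mul_div_cancel_left₀ _ hD2] using h3
    · rintro hv b ⟨h, hb⟩
      have h3 := hv h h.2
      rw [h2 h, hW h] at h3
      exact h3 _ hb
  refine ⟨(Set.finite_range Θ).subset hsub,
    (Set.ncard_le_ncard hsub (Set.finite_range Θ)).trans ?_⟩
  rw [← Nat.card_coe_set_eq]
  refine (Finite.card_range_le Θ).trans ?_
  have : Fintype (I → B) := Fintype.ofFinite _
  rw [Nat.card_eq_fintype_card, Fintype.card_set, rootSetsBound]
  refine Nat.pow_le_pow_right two_pos ?_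
  rw [← Nat.card_eq_fintype_card, Nat.card_fun, Nat.card_eq_fintype_card (α := I)]
  simp only [I, Fintype.card_fun, Fintype.card_fin]
  exact Nat.pow_le_pow_left (natCard_boxSpan_le _) _

end Descent

/-! ### Homogeneous coordinates, the group law and Frobenius -/

section Coordinates

variable {k U : Type*} [Field k] [Field U] [Algebra k U] {n : ℕ}

/-- The vector `v` is a vector of homogeneous coordinates of the point `x`. -/
def HasCoords (x : ProjPts U n) (v : Fin (n + 1) → U) : Prop :=
  ∃ a : U, a ≠ 0 ∧ x.rep = a • v

theorem hasCoords_mk (v : Fin (n + 1) → U) (hv : v ≠ 0) :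
    HasCoords (Projectivization.mk U v hv) v := by
  obtain ⟨a, ha⟩ := Projectivization.exists_smul_eq_mk_rep U v hv
  exact ⟨a, a.ne_zero, ha.symm⟩

theorem hasCoords_rep (x : ProjPts U n) : HasCoords x x.rep :=
  ⟨1, one_ne_zero, (one_smul _ _).symm⟩

theorem HasCoords.ne_zero {x : ProjPts U n} {v : Fin (n + 1) → U} (h : HasCoords x v) :
    v ≠ 0 := by
  rintro rfl
  obtain ⟨a, -, ha⟩ := h
  exact x.rep_nonzero (by rw [ha, smul_zero])

theorem HasCoords.eq_mk {x : ProjPts U n} {v : Fin (n + 1) → U} (h : HasCoords x v) :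
    x = Projectivization.mk U v h.ne_zero := by
  obtain ⟨a, ha, hx⟩ := id h
  conv_lhs => rw [← x.mk_rep]
  rw [Projectivization.mk_eq_mk_iff']
  exact ⟨a, hx.symm⟩

theorem HasCoords.smul {x : ProjPts U n} {v : Fin (n + 1) → U} (h : HasCoords x v) {b : U}
    (hb : b ≠ 0) : HasCoords x (b • v) := by
  obtain ⟨a, ha, hx⟩ := h
  exact ⟨a * b⁻¹, mul_ne_zero ha (inv_ne_zero hb), by rw [hx, smul_smul, inv_mul_cancel_right₀ hb]⟩

theorem HasCoords.vanishesAt_iff {R : Type*} [CommRing R] [Algebra R U] {x : ProjPts U n}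
    {v : Fin (n + 1) → U} (h : HasCoords x v) {d : ℕ} {f : MvPolynomial (Fin (n + 1)) R}
    (hf : f.IsHomogeneous d) : VanishesAt f x ↔ aeval v f = 0 := by
  conv_lhs => rw [h.eq_mk]
  exact vanishesAt_mk_iff hf v h.ne_zero

theorem isRationalPt_iff_exists_hasCoords {K : Type*} [Field K] [Algebra K U]
    (x : ProjPts U n) :
    IsRationalPt K x ↔ ∃ v : Fin (n + 1) → K, HasCoords x fun i => algebraMap K U (v i) := by
  constructor
  · rintro ⟨v, hv, rfl⟩
    exact ⟨v, hasCoords_mk _ hv⟩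
  · rintro ⟨v, hv⟩
    exact ⟨v, hv.ne_zero, hv.eq_mk⟩

theorem sum_eq_of_isBihomogeneous {R : Type*} [CommRing R]
    {f : MvPolynomial (Fin (n + 1) ⊕ Fin (n + 1)) R} {d e : ℕ} (hf : IsBihomogeneous f d e)
    {β : Fin (n + 1) ⊕ Fin (n + 1) →₀ ℕ} (hβ : β ∈ f.support) :
    ∑ i, β (Sum.inl i) = d ∧ ∑ i, β (Sum.inr i) = e := by
  have h1 := hf.1 (mem_support_iff.1 hβ)
  have h2 := hf.2 (mem_support_iff.1 hβ)
  rw [Finsupp.weight_apply, Finsupp.sum_fintype _ _ (by simp), Fintype.sum_sum_type] at h1 h2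
  simp only [Sum.elim_inl, Sum.elim_inr, smul_eq_mul, mul_one, mul_zero, Finset.sum_const_zero,
    add_zero, zero_add] at h1 h2
  exact ⟨h1, h2⟩

theorem aeval_smul_smul_of_isBihomogeneous {f : MvPolynomial (Fin (n + 1) ⊕ Fin (n + 1)) k}
    {d e : ℕ} (hf : IsBihomogeneous f d e) (a b : U) (v w : Fin (n + 1) → U) :
    aeval (Sum.elim (a • v) (b • w)) f = a ^ d * b ^ e * aeval (Sum.elim v w) f := by
  rw [aeval_def, aeval_def, eval₂_eq', eval₂_eq', Finset.mul_sum]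
  refine Finset.sum_congr rfl fun β hβ => ?_
  obtain ⟨h1, h2⟩ := sum_eq_of_isBihomogeneous hf hβ
  rw [← h1, ← h2]
  simp only [Fintype.prod_sum_type, Sum.elim_inl, Sum.elim_inr, Pi.smul_apply, smul_eq_mul,
    mul_pow, Finset.prod_mul_distrib, Finset.prod_pow_eq_pow_sum]
  ring

/-- A change of homogeneous coordinates multiplies the values of all bihomogeneous polynomials of
a given bidegree by the same factor. -/
theorem HasCoords.exists_evalPair_eq {x y : ProjPts U n} {v w : Fin (n + 1) → U}
    (hx : HasCoords x v) (hy : HasCoords y w) (d e : ℕ) :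
    ∃ a : U, a ≠ 0 ∧ ∀ f : MvPolynomial (Fin (n + 1) ⊕ Fin (n + 1)) k, IsBihomogeneous f d e →
      evalPair f x y = a * aeval (Sum.elim v w) f := by
  obtain ⟨a, ha, hx⟩ := hx
  obtain ⟨b, hb, hy⟩ := hy
  refine ⟨a ^ d * b ^ e, mul_ne_zero (pow_ne_zero _ ha) (pow_ne_zero _ hb), fun f hf => ?_⟩
  rw [evalPair, hx, hy, aeval_smul_smul_of_isBihomogeneous hf]

theorem BiChart.dom_iff {c : BiChart k n} {x y : ProjPts U n} {v w : Fin (n + 1) → U}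
    (hx : HasCoords x v) (hy : HasCoords y w) :
    c.Dom x y ↔ ∃ g ∈ c.opens, aeval (Sum.elim v w) g ≠ 0 := by
  refine exists_congr fun g => and_congr_right fun hg => ?_
  obtain ⟨d, e, hde⟩ := c.opens_bihomogeneous g hg
  obtain ⟨a, ha, h⟩ := hx.exists_evalPair_eq hy (k := k) d e
  rw [h g hde, Ne, mul_eq_zero, not_or]
  exact ⟨fun h => h.2, fun h => ⟨ha, h⟩⟩

theorem HasCoords.frobProj [Fintype k] {x : ProjPts U n} {v : Fin (n + 1) → U} (h : HasCoords x v) :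
    HasCoords (_root_.frobProj k x) fun i => v i ^ Fintype.card k := by
  rw [h.eq_mk]
  exact hasCoords_mk _ ((map_ne_zero_iff _ (frobVec_injective k U n)).2 h.ne_zero)

namespace CommAlgGroup

variable (G : CommAlgGroup k U n)

theorem hasCoords_add {c : BiChart k n} (hc : c ∈ G.law) {x y : G.Pts} {v w : Fin (n + 1) → U}
    (hx : HasCoords x.1 v) (hy : HasCoords y.1 w) (h : c.Dom x.1 y.1) :
    HasCoords (x + y).1 fun i => aeval (Sum.elim v w) (c.coord i) := by
  obtain ⟨h0, hxy⟩ := G.law_add c hc x y h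
  obtain ⟨d, e, hde⟩ := c.coord_bihomogeneous
  obtain ⟨a, ha, hev⟩ := hx.exists_evalPair_eq hy (k := k) d e
  have h1 := hasCoords_mk _ h0
  rw [← hxy] at h1
  have h2 := h1.smul (inv_ne_zero ha)
  have h3 : (a⁻¹ • fun i => evalPair (c.coord i) x.1 y.1)
      = fun i => aeval (Sum.elim v w) (c.coord i) := by
    funext i
    rw [Pi.smul_apply, hev _ (hde i), smul_eq_mul, inv_mul_cancel_left₀ ha]
  rwa [h3] at h2

variable [Fintype k]

theorem hasCoords_frob_iterate {x : G.Pts} {v : Fin (n + 1) → U} (h : HasCoords x.1 v) (m : ℕ) :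
    HasCoords (G.frob^[m] x).1 fun i => v i ^ Fintype.card k ^ m := by
  induction m with
  | zero => simpa using h
  | succ m ih =>
    rw [Function.iterate_succ_apply']
    have h1 := ih.frobProj (k := k)
    simp only [← pow_mul, ← pow_succ] at h1
    exact h1

end CommAlgGroup

end Coordinates

section Translate

variable {k K : Type*} [Field k] [Field K] {n : ℕ}

/-- The polynomial in the coordinates of `x` whose vanishing expresses that, if `(x, w)` lies
where `g` does not vanish, then the point with coordinates `P (x, w)` satisfies the equation `f`.
All coefficients are multiplied by `h`, which serves to clear denominators. -/
def translatePoly {R : Type*} [CommRing R] [Algebra k R] [Algebra K R] (h : R)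
    (w : Fin (n + 1) → R) (g : MvPolynomial (Fin (n + 1) ⊕ Fin (n + 1)) k)
    (P : Fin (n + 1) → MvPolynomial (Fin (n + 1) ⊕ Fin (n + 1)) k)
    (f : MvPolynomial (Fin (n + 1)) K) : MvPolynomial (Fin (n + 1)) R :=
  (C h * aeval (Sum.elim X fun i => C (w i)) g) *
    (C h * aeval (fun i => C h * aeval (Sum.elim X fun i => C (w i)) (P i)) f)

theorem aeval_translatePoly {R R' : Type*} [CommRing R] [Algebra k R] [Algebra K R] [CommRing R']
    [Algebra R R'] [Algebra k R'] [Algebra K R'] [IsScalarTower k R R'] [IsScalarTower K R R']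
    (h : R) (w : Fin (n + 1) → R)
    (g : MvPolynomial (Fin (n + 1) ⊕ Fin (n + 1)) k)
    (P : Fin (n + 1) → MvPolynomial (Fin (n + 1) ⊕ Fin (n + 1)) k)
    (f : MvPolynomial (Fin (n + 1)) K) (v : Fin (n + 1) → R') :
    aeval v (translatePoly h w g P f) =
      (algebraMap R R' h * aeval (Sum.elim v fun i => algebraMap R R' (w i)) g) *
      (algebraMap R R' h * aeval (fun i => algebraMap R R' h *
        aeval (Sum.elim v fun i => algebraMap R R' (w i)) (P i)) f) := by
  have h1 : ∀ g : MvPolynomial (Fin (n + 1) ⊕ Fin (n + 1)) k,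
      aeval v (aeval (Sum.elim X fun i => C (w i) : _ → MvPolynomial (Fin (n + 1)) R) g)
        = aeval (Sum.elim v fun i => algebraMap R R' (w i)) g := by
    intro g
    rw [← AlgHom.restrictScalars_apply k (aeval v : MvPolynomial (Fin (n + 1)) R →ₐ[R] R'),
      ← AlgHom.comp_apply, comp_aeval]
    congr 2
    funext i
    cases i <;> simp
  have h2 : ∀ u : Fin (n + 1) → MvPolynomial (Fin (n + 1)) R,
      aeval v (aeval u f) = aeval (fun i => aeval v (u i)) f := by
    intro u
    rw [← AlgHom.restrictScalars_apply K (aeval v : MvPolynomial (Fin (n + 1)) R →ₐ[R] R'),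
      ← AlgHom.comp_apply, comp_aeval]
    rfl
  rw [translatePoly, map_mul, map_mul, map_mul, h2, h1]
  simp only [map_mul, h1, aeval_C]

variable {U : Type*} [Field U] [Algebra k U] [Algebra K U]

theorem isHomogeneous_aeval_sumElim {f : MvPolynomial (Fin (n + 1) ⊕ Fin (n + 1)) k}
    {d e : ℕ} (hf : IsBihomogeneous f d e) (w : Fin (n + 1) → U) :
    (aeval (Sum.elim X fun i => C (w i) : _ → MvPolynomial (Fin (n + 1)) U) f).IsHomogeneous
      d := by
  rw [aeval_def, eval₂_eq']
  refine IsHomogeneous.sum _ _ _ fun β hβ => ?_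
  have h1 := (sum_eq_of_isBihomogeneous hf hβ).1
  rw [MvPolynomial.algebraMap_apply, Fintype.prod_sum_type]
  simp only [Sum.elim_inl, Sum.elim_inr, ← map_pow, ← map_prod]
  have h2 : (∏ i, X i ^ β (Sum.inl i) : MvPolynomial (Fin (n + 1)) U).IsHomogeneous d := by
    rw [← h1]
    exact IsHomogeneous.prod _ _ _ fun i _ => isHomogeneous_X_pow i _
  have h3 := ((isHomogeneous_C (Fin (n + 1)) (algebraMap k U (coeff β f))).mul h2).mul
    (isHomogeneous_C (Fin (n + 1)) (∏ i, w i ^ β (Sum.inr i)))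
  rw [zero_add, add_zero, mul_assoc] at h3
  exact h3

theorem isHomogeneous_translatePoly (h : U) (w : Fin (n + 1) → U)
    {g : MvPolynomial (Fin (n + 1) ⊕ Fin (n + 1)) k}
    {P : Fin (n + 1) → MvPolynomial (Fin (n + 1) ⊕ Fin (n + 1)) k}
    {f : MvPolynomial (Fin (n + 1)) K} (hg : ∃ d e, IsBihomogeneous g d e)
    (hP : ∃ d e, ∀ i, IsBihomogeneous (P i) d e) (hf : ∃ d, f.IsHomogeneous d) :
    ∃ d, (translatePoly h w g P f).IsHomogeneous d := by
  obtain ⟨d₁, e₁, hg⟩ := hg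
  obtain ⟨d₂, e₂, hP⟩ := hP
  obtain ⟨D, hf⟩ := hf
  exact ⟨_, ((isHomogeneous_C _ h).mul (isHomogeneous_aeval_sumElim hg w)).mul
    ((isHomogeneous_C _ h).mul (hf.aeval _ fun i =>
      (isHomogeneous_C _ h).mul (isHomogeneous_aeval_sumElim (hP i) w)))⟩

namespace CommAlgGroup

variable (G : CommAlgGroup k U n)

/-- Membership in a translate of a closed subvariety, in terms of coordinates. -/
theorem add_mem_iff {X : Set G.Pts} {Q : List (MvPolynomial (Fin (n + 1)) K)}
    (hX : G.IsDefinedBy X Q) {x y : G.Pts} {v w : Fin (n + 1) → U} (hx : HasCoords x.1 v)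
    (hy : HasCoords y.1 w) {h : U} (hh : h ≠ 0) :
    x + y ∈ X ↔ ∀ c ∈ G.law, ∀ g ∈ c.opens, ∀ f ∈ Q,
      aeval v (translatePoly h w g c.coord f) = 0 := by
  have hval : ∀ c : BiChart k n, ∀ g (f : MvPolynomial (Fin (n + 1)) K),
      aeval v (translatePoly h w g c.coord f) = 0 ↔
      aeval (Sum.elim v w) g = 0 ∨
        aeval (h • fun i => aeval (Sum.elim v w) (c.coord i)) f = 0 := by
    intro c g f
    rw [aeval_translatePoly, mul_eq_zero, mul_eq_zero, mul_eq_zero]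
    simp only [Algebra.algebraMap_self, RingHom.id_apply, hh, false_or]
    rfl
  constructor
  · intro hxy c hc g hg f hf
    rw [hval]
    refine or_iff_not_imp_left.2 fun hne => ?_
    have h1 := (G.hasCoords_add hc hx hy ((BiChart.dom_iff hx hy).2 ⟨g, hg, hne⟩)).smul hh
    obtain ⟨d, hd⟩ := hX.1 f hf
    rw [hX.2] at hxy
    exact (h1.vanishesAt_iff hd).1 (hxy f hf)
  · intro hall
    rw [hX.2]
    intro f hf
    obtain ⟨c, hc, hdom⟩ := G.law_cover x y
    obtain ⟨g, hg, hne⟩ := (BiChart.dom_iff hx hy).1 hdom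
    obtain ⟨d, hd⟩ := hX.1 f hf
    have h1 := (G.hasCoords_add hc hx hy hdom).smul hh
    exact (h1.vanishesAt_iff hd).2 (((hval c g f).1 (hall c hc g hg f hf)).resolve_left hne)

/-- The Frobenius transform of a translate of a closed subvariety is the preimage of this
translate under the corresponding power of Frobenius. -/
theorem mem_frobTransform_iff [Fintype k] [IsAlgClosed U] {X : Set G.Pts}
    {Q : List (MvPolynomial (Fin (n + 1)) K)} (hX : G.IsDefinedBy X Q) (γ x : G.Pts) (m : ℕ) :
    x ∈ G.frobTransform ((fun y => y - γ) '' X) m ↔ G.frob^[m] x + γ ∈ X := by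
  obtain ⟨p, hchar⟩ := CharP.exists k
  have : CharP U p := charP_of_injective_algebraMap (algebraMap k U).injective p
  obtain ⟨e, hp, hcard⟩ := FiniteField.card k p
  have : Fact p.Prime := ⟨hp⟩
  have hq : Fintype.card k ^ m = p ^ ((e : ℕ) * m) := by rw [hcard, pow_mul]
  have hpow : ∀ f g : MvPolynomial (Fin (n + 1)) U,
      (∀ s, f.coeff s ^ Fintype.card k ^ m = g.coeff s) →
      aeval x.1.rep f ^ Fintype.card k ^ m
        = aeval (fun i => x.1.rep i ^ Fintype.card k ^ m) g := by
    intro f g hfg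
    have h1 : map (iterateFrobenius U p (e * m)) f = g := by
      ext s
      rw [coeff_map, iterateFrobenius_def, ← hq, hfg]
    rw [← h1, hq, ← iterateFrobenius_def, aeval_def, aeval_def, eval₂_map, hom_eval₂]
    simp [iterateFrobenius_def]
  have hxm := G.hasCoords_frob_iterate (hasCoords_rep x.1) m
  constructor
  · intro hx
    by_contra hnot
    rw [G.add_mem_iff hX hxm (hasCoords_rep γ.1) one_ne_zero] at hnot
    push Not at hnot
    obtain ⟨c, hc, g, hg, f, hf, hne⟩ := hnot
    set t := translatePoly (1 : U) γ.1.rep g c.coord f with ht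
    obtain ⟨d, hd⟩ := isHomogeneous_translatePoly (1 : U) γ.1.rep
      (c.opens_bihomogeneous g hg) c.coord_bihomogeneous (hX.1 f hf)
    -- the polynomial whose coefficients are the roots of those of `t`
    let t' := map ((iterateFrobeniusEquiv U p (e * m)).symm : U →+* U) t
    have ht' : ∀ s, t'.coeff s ^ Fintype.card k ^ m = t.coeff s := by
      intro s
      rw [coeff_map, hq, ← iterateFrobenius_def]
      exact (iterateFrobeniusEquiv U p (e * m)).apply_symm_apply _
    have h1 := hx d t' t hd (by
      rintro _ ⟨y, hy, rfl⟩
      rw [(hasCoords_rep _).vanishesAt_iff hd]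
      exact (G.add_mem_iff hX (hasCoords_rep (y - γ).1) (hasCoords_rep γ.1) one_ne_zero).1
        (by rwa [sub_add_cancel]) c hc g hg f hf) ht'
    refine hne ?_
    rw [← hpow t' t ht', show aeval x.1.rep t' = 0 from h1, zero_pow]
    exact pow_ne_zero _ Fintype.card_ne_zero
  · intro hx d f g hg hvan hfg
    have h1 := hvan (G.frob^[m] x) ⟨_, hx, add_sub_cancel_right _ _⟩
    rw [hxm.vanishesAt_iff hg, ← hpow f g hfg] at h1
    exact eq_zero_of_pow_eq_zero h1

end CommAlgGroup

end Translate

/-! ### Sizes of translated equations and of expansions -/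

/-- Size of the value of a polynomial in a filtered algebra: the coefficients, multiplied by `h`,
have size at most `M`, the variable `i` has size `w i`. -/
theorem mul_aeval_mem_of_filtration {k R σ : Type*} [Fintype σ] [CommRing k] [CommRing R]
    [Algebra k R] (Fil : ℕ → AddSubmonoid R) (hmono : Monotone Fil) (hone : 1 ∈ Fil 0)
    (hmul : ∀ a b x y, x ∈ Fil a → y ∈ Fil b → x * y ∈ Fil (a + b)) {h : R} {M W : ℕ}
    {f : MvPolynomial σ k} (hf : ∀ β, h * algebraMap k R (f.coeff β) ∈ Fil M) {v : σ → R}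
    {w : σ → ℕ} (hv : ∀ i, v i ∈ Fil (w i)) (hW : ∀ β ∈ f.support, ∑ i, β i * w i ≤ W) :
    h * aeval v f ∈ Fil (M + W) := by
  classical
  have hpow : ∀ (a m : ℕ) (x : R), x ∈ Fil a → x ^ m ∈ Fil (m * a) := by
    intro a m x hx
    induction m with
    | zero => simpa using hone
    | succ m ih => simpa [pow_succ, add_mul] using hmul _ _ _ _ ih hx
  have hprod : ∀ (β : σ →₀ ℕ) (S : Finset σ), ∏ i ∈ S, v i ^ β i ∈ Fil (∑ i ∈ S, β i * w i) := by
    intro β S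
    induction S using Finset.induction_on with
    | empty => simpa using hone
    | insert i S hi ih =>
      rw [Finset.prod_insert hi, Finset.sum_insert hi]
      exact hmul _ _ _ _ (hpow _ _ _ (hv i)) ih
  rw [aeval_def, eval₂_eq', Finset.mul_sum]
  refine sum_mem fun β hβ => ?_
  rw [← mul_assoc]
  exact hmono (Nat.add_le_add_left (hW β hβ) _) (hmul _ _ _ _ (hf β) (hprod β Finset.univ))

theorem sum_le_of_mem_support {k σ : Type*} [Fintype σ] [CommRing k] {f : MvPolynomial σ k}
    {β : σ →₀ ℕ} (hβ : β ∈ f.support) : ∑ i, β i ≤ f.totalDegree := by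
  have h := le_totalDegree hβ
  rwa [Finsupp.sum_fintype _ _ (by simp)] at h

theorem sum_mul_le_of_mem_support {k σ : Type*} [Fintype σ] [CommRing k] {f : MvPolynomial σ k}
    {β : σ →₀ ℕ} (hβ : β ∈ f.support) {w : σ → ℕ} {L d : ℕ} (hw : ∀ i, w i ≤ L)
    (hd : f.totalDegree ≤ d) : ∑ i, β i * w i ≤ d * L := by
  calc ∑ i, β i * w i ≤ ∑ i, β i * L :=
        Finset.sum_le_sum fun i _ => Nat.mul_le_mul_left _ (hw i)
    _ = (∑ i, β i) * L := (Finset.sum_mul _ _ _).symm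
    _ ≤ d * L := Nat.mul_le_mul_right _ ((sum_le_of_mem_support hβ).trans hd)

section Size

variable {p : ℕ} {k K : Type*} [Field k] [Field K] [Algebra k K] [Algebra (ZMod p) K]
  {s : ℕ} {c : Fin s → K} {n : ℕ}

/-- The polynomials all of whose coefficients are in `boxSpan p c N`. -/
def coeffFil (p : ℕ) {K : Type*} [Field K] [Algebra (ZMod p) K] {s : ℕ} (c : Fin s → K)
    (σ : Type*) (N : ℕ) : AddSubmonoid (MvPolynomial σ K) where
  carrier := {f | ∀ β, f.coeff β ∈ boxSpan p c N}
  add_mem' hf hg β := by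
    rw [coeff_add]
    exact add_mem (hf β) (hg β)
  zero_mem' β := by
    rw [coeff_zero]
    exact zero_mem _

theorem coeffFil_mono {σ : Type*} : Monotone (coeffFil p c σ) :=
  fun _ _ h _ hf β => boxSpan_mono h (hf β)

theorem C_mem_coeffFil {σ : Type*} {N : ℕ} {x : K} (hx : x ∈ boxSpan p c N) :
    (C x : MvPolynomial σ K) ∈ coeffFil p c σ N := by
  classical
  intro β
  rw [coeff_C]
  split_ifs
  · exact hx
  · exact zero_mem _

theorem X_mem_coeffFil {σ : Type*} {N : ℕ} (i : σ) :
    (X i : MvPolynomial σ K) ∈ coeffFil p c σ N := by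
  classical
  intro β
  rw [coeff_X]
  split_ifs
  · exact one_mem_boxSpan
  · exact zero_mem _

theorem mul_mem_coeffFil {σ : Type*} (M N : ℕ) (f g : MvPolynomial σ K)
    (hf : f ∈ coeffFil p c σ M) (hg : g ∈ coeffFil p c σ N) : f * g ∈ coeffFil p c σ (M + N) := by
  classical
  intro β
  rw [coeff_mul]
  exact Submodule.sum_mem _ fun x _ => mul_mem_boxSpan (hf _) (hg _)

/-- The polynomials of total degree at most `N`. -/
def degreeFil (K : Type*) [Field K] (σ : Type*) (N : ℕ) : AddSubmonoid (MvPolynomial σ K) where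
  carrier := {f | f.totalDegree ≤ N}
  add_mem' hf hg := (totalDegree_add _ _).trans (max_le hf hg)
  zero_mem' := by simp

/-- A bound for the sizes of the coefficients of translated equations by expansions of words of
length at most `l`, divided by `Q ^ l`. -/
def heightBound (M Q : ℕ) : ℕ :=
  (M + M * (2 * Q * M)) + (M + M * (M + Q * (2 * Q * M)))

theorem translatePoly_mem_coeffFil {h : K} {M L Q : ℕ} {w : Fin (n + 1) → K}
    (hw : ∀ i, w i ∈ boxSpan p c L) {g : MvPolynomial (Fin (n + 1) ⊕ Fin (n + 1)) k}
    (hg : ∀ β, h * algebraMap k K (g.coeff β) ∈ boxSpan p c M) (hgd : g.totalDegree ≤ M)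
    {P : Fin (n + 1) → MvPolynomial (Fin (n + 1) ⊕ Fin (n + 1)) k}
    (hP : ∀ i β, h * algebraMap k K ((P i).coeff β) ∈ boxSpan p c M)
    (hPd : ∀ i, (P i).totalDegree ≤ Q) {f : MvPolynomial (Fin (n + 1)) K}
    (hf : ∀ β, h * f.coeff β ∈ boxSpan p c M) (hfd : f.totalDegree ≤ M) :
    translatePoly h w g P f ∈
      coeffFil p c (Fin (n + 1)) ((M + M * L) + (M + M * (M + Q * L))) := by
  have key : ∀ (g : MvPolynomial (Fin (n + 1) ⊕ Fin (n + 1)) k) (d : ℕ),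
      (∀ β, h * algebraMap k K (g.coeff β) ∈ boxSpan p c M) → g.totalDegree ≤ d →
      C h * aeval (Sum.elim X fun i => C (w i) : _ → MvPolynomial (Fin (n + 1)) K) g ∈
        coeffFil p c (Fin (n + 1)) (M + d * L) := by
    intro g d hg hgd
    refine mul_aeval_mem_of_filtration (coeffFil p c (Fin (n + 1))) coeffFil_mono
      (C_mem_coeffFil (by exact one_mem_boxSpan)) mul_mem_coeffFil (fun β => ?_)
      (w := fun _ => L) (fun i => ?_)
      fun β hβ => sum_mul_le_of_mem_support hβ (fun _ => le_rfl) hgd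
    · rw [MvPolynomial.algebraMap_apply, ← C_mul]
      exact C_mem_coeffFil (hg β)
    · cases i with
      | inl i => exact X_mem_coeffFil i
      | inr i => exact C_mem_coeffFil (hw i)
  refine mul_mem_coeffFil _ _ _ _ (key g M hg hgd) ?_
  refine mul_aeval_mem_of_filtration (coeffFil p c (Fin (n + 1))) coeffFil_mono
    (C_mem_coeffFil (by exact one_mem_boxSpan)) mul_mem_coeffFil (fun β => ?_)
    (w := fun _ => M + Q * L) (fun i => key (P i) Q (hP i) (hPd i))
    fun β hβ => sum_mul_le_of_mem_support hβ (fun _ => le_rfl) hfd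
  rw [MvPolynomial.algebraMap_apply, ← C_mul]
  exact C_mem_coeffFil (hf β)

theorem totalDegree_translatePoly_le (h : K) {M Q : ℕ} (w : Fin (n + 1) → K)
    {g : MvPolynomial (Fin (n + 1) ⊕ Fin (n + 1)) k} (hgd : g.totalDegree ≤ M)
    {P : Fin (n + 1) → MvPolynomial (Fin (n + 1) ⊕ Fin (n + 1)) k}
    (hPd : ∀ i, (P i).totalDegree ≤ Q) {f : MvPolynomial (Fin (n + 1)) K}
    (hfd : f.totalDegree ≤ M) : (translatePoly h w g P f).totalDegree ≤ M + M * Q := by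
  have hmono : Monotone (degreeFil K (Fin (n + 1))) := fun _ _ h _ hf => le_trans hf h
  have hC : ∀ x : K, (C x : MvPolynomial (Fin (n + 1)) K) ∈ degreeFil K (Fin (n + 1)) 0 :=
    fun x => (totalDegree_C x).le
  have hmul : ∀ a b (x y : MvPolynomial (Fin (n + 1)) K), x ∈ degreeFil K (Fin (n + 1)) a →
      y ∈ degreeFil K (Fin (n + 1)) b → x * y ∈ degreeFil K (Fin (n + 1)) (a + b) :=
    fun a b x y hx hy => (totalDegree_mul x y).trans (add_le_add hx hy)
  have key : ∀ (g : MvPolynomial (Fin (n + 1) ⊕ Fin (n + 1)) k) (d : ℕ), g.totalDegree ≤ d →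
      C h * aeval (Sum.elim X fun i => C (w i) : _ → MvPolynomial (Fin (n + 1)) K) g ∈
        degreeFil K (Fin (n + 1)) (0 + d * 1) := by
    intro g d hgd
    refine mul_aeval_mem_of_filtration _ hmono (hC 1) hmul (fun β => ?_) (w := fun _ => 1)
      (fun i => ?_) fun β hβ => sum_mul_le_of_mem_support hβ (fun _ => le_rfl) hgd
    · rw [MvPolynomial.algebraMap_apply, ← C_mul]
      exact hC _
    · cases i with
      | inl i => exact (totalDegree_X i).le
      | inr i => exact hmono zero_le_one (hC _)
  have h1 : translatePoly h w g P f ∈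
      degreeFil K (Fin (n + 1)) ((0 + M * 1) + (0 + M * (0 + Q * 1))) := by
    refine hmul _ _ _ _ (key g M hgd) ?_
    refine mul_aeval_mem_of_filtration _ hmono (hC 1) hmul (fun β => ?_)
      (w := fun _ => 0 + Q * 1) (fun i => key (P i) Q (hPd i))
      fun β hβ => sum_mul_le_of_mem_support hβ (fun _ => le_rfl) hfd
    rw [MvPolynomial.algebraMap_apply, ← C_mul]
    exact hC _
  simp only [zero_add, mul_one] at h1
  exact h1

end Size

section Heights

variable {p : ℕ} {k K U : Type*} [Field k] [Fintype k] [Field K] [Field U] [Algebra k K]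
  [Algebra k U] [Algebra K U] [IsScalarTower k K U] [Algebra (ZMod p) K] {s : ℕ} {c : Fin s → K}
  {n : ℕ}

theorem expansion_append_singleton {A : Type*} [AddCommGroup A] (F : A → A) (w : List A) (x : A) :
    expansion F (w ++ [x]) = expansion F w + F^[w.length] x := by
  have h : ∀ w : List A, expansion F w = ∑ i ∈ Finset.range w.length,
      F^[i] (w.getD i 0) := by
    intro w
    rw [expansion, Finset.sum_range]
    exact Finset.sum_congr rfl fun i _ => by simp
  rw [h, h, List.length_append, List.length_singleton, Finset.sum_range_succ]
  congr 1
  · refine Finset.sum_congr rfl fun i hi => ?_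
    rw [List.getD_append _ _ _ _ (Finset.mem_range.1 hi)]
  · simp

/-- The height recursion: the bound `2 * Q * M * Q ^ m - M` is passed on from `m` to `m + 1` when a
term of size `Q ^ m * M` is added by polynomials of bidegree `(d, e)` with `d + e ≤ Q`.  The
subtracted `M` absorbs the size of the coefficients if `e = 0`, where `d = Q` is possible. -/
theorem height_step {Q M d e m H : ℕ} (hQ : 2 ≤ Q) (hde : d + e ≤ Q) (hm : 1 ≤ m)
    (hH : H + M ≤ 2 * Q * M * Q ^ m) :
    M + (d * H + e * (Q ^ m * M)) + M ≤ 2 * Q * M * Q ^ (m + 1) := by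
  have h1 : 2 ≤ Q ^ m := hQ.trans (Nat.le_self_pow (by omega) Q)
  obtain ⟨d', rfl⟩ : ∃ d', Q = d + e + d' := ⟨Q - (d + e), by omega⟩
  set Q := d + e + d' with hQd
  set T := Q ^ m with hT
  rw [pow_succ, ← hT]
  rcases Nat.eq_zero_or_pos e with rfl | he
  · have h2 : d * H + d * M ≤ d * (2 * Q * M * T) := by
      rw [← mul_add]
      exact Nat.mul_le_mul_left _ hH
    have h3 : d ≤ Q := by omega
    rcases Nat.lt_or_ge d 2 with hd | hd
    · have h4 : d * H ≤ 2 * Q * M * T := by nlinarith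
      have h5 : 2 * M ≤ 2 * Q * M * T := by
        calc 2 * M = 2 * 1 * M * 1 := by ring
          _ ≤ 2 * Q * M * T := by gcongr <;> omega
      nlinarith
    · have h4 : d * (2 * Q * M * T) ≤ 2 * Q * M * (T * Q) := by
        calc d * (2 * Q * M * T) ≤ Q * (2 * Q * M * T) := Nat.mul_le_mul_right _ h3
          _ = _ := by ring
      nlinarith
  · have h3 : d * H ≤ d * (2 * Q * M * T) := Nat.mul_le_mul_left _ (by omega)
    have h4 : d + 1 ≤ Q := by omega
    have h5 : e * (T * M) ≤ Q * (T * M) := Nat.mul_le_mul_right _ (by omega)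
    have h6 : 2 * M ≤ Q * (T * M) := by
      calc 2 * M = 2 * (1 * M) := by ring
        _ ≤ Q * (T * M) := by gcongr; omega
    calc M + (d * H + e * (T * M)) + M
        ≤ d * (2 * Q * M * T) + 2 * (Q * (T * M)) := by omega
      _ = (d + 1) * (2 * Q * M * T) := by ring
      _ ≤ Q * (2 * Q * M * T) := Nat.mul_le_mul_right _ h4
      _ = _ := by ring

/-- The `F ^ r`-expansions of nonempty words of length `m` have coordinates of size `O(q ^ (r m))`,
because the group law has degree at most `q ^ r`. -/
theorem exists_hasCoords_expansion (G : CommAlgGroup k U n) {S : Set G.Pts} {r : ℕ} (hr : 0 < r)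
    (hdeg : ∀ c ∈ G.law, ∀ i, (c.coord i).totalDegree ≤ Fintype.card k ^ r) {h : K} (hh : h ≠ 0)
    {M : ℕ} (hcoord : ∀ b ∈ G.law, ∀ i β,
      h * algebraMap k K ((b.coord i).coeff β) ∈ boxSpan p c M)
    (hS : ∀ x ∈ S, ∃ u : Fin (n + 1) → K, HasCoords x.1 (fun i => algebraMap K U (u i)) ∧
      ∀ i, u i ∈ boxSpan p c M)
    (w : List G.Pts) (hw : ∀ x ∈ w, x ∈ S) (hw0 : w ≠ []) :
    ∃ u : Fin (n + 1) → K,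
      HasCoords (expansion (G.frob^[r]) w).1 (fun i => algebraMap K U (u i)) ∧
      ∃ H, H + M ≤ 2 * Fintype.card k ^ r * M * (Fintype.card k ^ r) ^ w.length ∧
        ∀ i, u i ∈ boxSpan p c H := by
  set Q := Fintype.card k ^ r with hQ
  have hQ2 : 2 ≤ Q := (Fintype.one_lt_card (α := k)).trans_le (Nat.le_self_pow hr.ne' _)
  induction w using List.reverseRecOn with
  | nil => exact absurd rfl hw0
  | append_singleton w x ih =>
    obtain ⟨ux, hux, huxM⟩ := hS x (hw x (by simp))
    rw [expansion_append_singleton]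
    rcases eq_or_ne w [] with rfl | hne
    · refine ⟨ux, ?_, M, ?_, huxM⟩
      · simpa [expansion] using hux
      · simp only [List.nil_append, List.length_singleton, pow_one]
        calc M + M = 2 * 1 * M * 1 := by ring
          _ ≤ 2 * Q * M * Q := by gcongr <;> omega
    · obtain ⟨u, hu, H, hH, huH⟩ := ih (fun y hy => hw y (by simp [hy])) hne
      set m := w.length with hm
      have hm1 : 1 ≤ m := List.length_pos_iff.2 hne
      have hFx := G.hasCoords_frob_iterate hux (r * m)
      rw [Function.iterate_mul] at hFx
      have hQm : Fintype.card k ^ (r * m) = Q ^ m := by rw [hQ, pow_mul]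
      rw [hQm] at hFx
      simp only [← map_pow] at hFx
      obtain ⟨b, hb, hdom⟩ := G.law_cover (expansion (G.frob^[r]) w) ((G.frob^[r])^[m] x)
      have hsum := (G.hasCoords_add hb hu hFx hdom).smul
        ((map_ne_zero (algebraMap K U)).2 hh)
      obtain ⟨d, e, hde⟩ := b.coord_bihomogeneous
      set y : Fin (n + 1) → K := fun i => h * aeval (Sum.elim u fun i => ux i ^ Q ^ m) (b.coord i)
        with hy
      have hval : (algebraMap K U h • fun i => aeval (Sum.elim (fun i => algebraMap K U (u i))
          fun i => algebraMap K U (ux i ^ Q ^ m)) (b.coord i)) = fun i => algebraMap K U (y i) := by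
        funext i
        rw [Pi.smul_apply, smul_eq_mul, hy, map_mul, ← aeval_algebraMap_apply]
        congr 3
        funext j
        cases j <;> rfl
      rw [hval] at hsum
      refine ⟨y, hsum, M + (d * H + e * (Q ^ m * M)), ?_, fun i => ?_⟩
      · -- some coordinate polynomial does not vanish, so that `d + e` is its total degree
        have hde' : d + e ≤ Q := by
          obtain ⟨i, hi⟩ := Function.ne_iff.1 hsum.ne_zero
          have h0 : b.coord i ≠ 0 := by
            intro h0
            simp [hy, h0] at hi
          obtain ⟨β, hβ⟩ := support_nonempty.2 h0
          have h1 := sum_eq_of_isBihomogeneous (hde i) hβ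
          have h2 := sum_le_of_mem_support hβ
          rw [Fintype.sum_sum_type, h1.1, h1.2] at h2
          exact h2.trans (hdeg b hb i)
        simpa using height_step hQ2 hde' hm1 hH
      · refine mul_aeval_mem_of_filtration (fun N => (boxSpan p c N).toAddSubmonoid)
          (fun _ _ h => boxSpan_mono h) one_mem_boxSpan (fun _ _ _ _ hx hy => mul_mem_boxSpan hx hy)
          (hcoord b hb i) (w := Sum.elim (fun _ => H) fun _ => Q ^ m * M) (fun j => ?_)
          fun β hβ => ?_
        · cases j with
          | inl j => exact huH j
          | inr j => exact pow_mem_boxSpan (huxM j) _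
        · have h1 := sum_eq_of_isBihomogeneous (hde i) hβ
          rw [Fintype.sum_sum_type]
          simp only [Sum.elim_inl, Sum.elim_inr, ← Finset.sum_mul, h1.1, h1.2]
          exact le_rfl

end Heights

/-! ### The finiteness theorem for data of bounded size -/

section Core

variable {p : ℕ} [Fact p.Prime] {k K U : Type*} [Field k] [Fintype k] [Field K] [Field U]
  [IsAlgClosed U] [Algebra k K] [Algebra k U] [Algebra K U] [IsScalarTower k K U]
  [Algebra (ZMod p) K] {s : ℕ} {c : Fin s → K} {n : ℕ}

/-- Up to passing to homogeneous coordinates, the sets in question are cut out by polynomials in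
high Frobenius powers of the coordinates whose coefficients have size proportional to this
power. -/
theorem pullbackSets_subset_image_rootSets (G : CommAlgGroup k U n) {X S : Set G.Pts} {r : ℕ}
    (hr : 0 < r)
    (hdeg : ∀ b ∈ G.law, ∀ i, (b.coord i).totalDegree ≤ Fintype.card k ^ r) {h : K} (hh : h ≠ 0)
    {M : ℕ} (hcoord : ∀ b ∈ G.law, ∀ i β,
      h * algebraMap k K ((b.coord i).coeff β) ∈ boxSpan p c M)
    (hopens : ∀ b ∈ G.law, ∀ g ∈ b.opens, g.totalDegree ≤ M ∧
      ∀ β, h * algebraMap k K (g.coeff β) ∈ boxSpan p c M)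
    {Q : List (MvPolynomial (Fin (n + 1)) K)} (hX : G.IsDefinedBy X Q)
    (hQ : ∀ f ∈ Q, f.totalDegree ≤ M ∧ ∀ β, h * f.coeff β ∈ boxSpan p c M)
    (hS : ∀ x ∈ S, ∃ u : Fin (n + 1) → K, HasCoords x.1 (fun i => algebraMap K U (u i)) ∧
      ∀ i, u i ∈ boxSpan p c M) :
    G.pullbackSets K X S r ⊆
      (fun Z : Set (Fin (n + 1) → K) =>
        {x : G.Pts | ∃ v ∈ Z, HasCoords x.1 fun i => algebraMap K U (v i)}) ''
      rootSets p c (heightBound M (Fintype.card k ^ r)) (M + M * Fintype.card k ^ r) (n + 1) := by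
  rintro _ ⟨l, γ, ⟨w, hwS, hwl, rfl⟩, rfl⟩
  have : CharP K p := charP_of_injective_algebraMap (algebraMap (ZMod p) K).injective p
  have : CharP k p := (RingHom.charP_iff (algebraMap k K) (algebraMap k K).injective p).2 inferInstance
  obtain ⟨e, -, hcard⟩ := FiniteField.card k p
  set q := Fintype.card k with hq
  have hpow : q ^ (l * r) = p ^ ((e : ℕ) * (l * r)) := by rw [hcard, ← pow_mul]
  have hQ1 : 1 ≤ q ^ (l * r) := Nat.one_le_pow _ _ Fintype.card_pos
  set γ := expansion (G.frob^[r]) w with hγ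
  -- it suffices to describe the condition on the coordinates by polynomials of the right size
  suffices hP : ∃ P : Set (MvPolynomial (Fin (n + 1)) K),
      (∀ t ∈ P, (∀ β, t.coeff β ∈ boxSpan p c (heightBound M (q ^ r) * q ^ (l * r))) ∧
        t.totalDegree ≤ M + M * q ^ r) ∧
      ∀ (x : G.Pts) (v : Fin (n + 1) → K), HasCoords x.1 (fun i => algebraMap K U (v i)) →
        (G.frob^[l * r] x + γ ∈ X ↔ ∀ t ∈ P, eval (fun i => v i ^ q ^ (l * r)) t = 0) by
    obtain ⟨P, hPb, hP⟩ := hP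
    refine ⟨_, ⟨(e : ℕ) * (l * r), P, ?_, rfl⟩, Set.ext fun x => ?_⟩
    · rw [← hpow]
      exact hPb
    · simp only [Set.mem_ofPred_eq, CommAlgGroup.ratPoints, ← hpow,
        isRationalPt_iff_exists_hasCoords, G.mem_frobTransform_iff hX]
      constructor
      · rintro ⟨v, hv, hxv⟩
        exact ⟨(hP x v hxv).2 hv, v, hxv⟩
      · rintro ⟨hx, v, hxv⟩
        exact ⟨v, (hP x v hxv).1 hx, hxv⟩
  have hevU : ∀ (t : MvPolynomial (Fin (n + 1)) K) (v : Fin (n + 1) → K),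
      aeval (fun i => algebraMap K U (v i) ^ q ^ (l * r)) t = 0 ↔
        eval (fun i => v i ^ q ^ (l * r)) t = 0 := by
    intro t v
    have h1 := aeval_algebraMap_apply (R := K) U (fun i => v i ^ q ^ (l * r)) t
    have h2 : (algebraMap K U ∘ fun i => v i ^ q ^ (l * r))
        = fun i => algebraMap K U (v i) ^ q ^ (l * r) := by
      funext i
      exact map_pow _ _ _
    rw [h2] at h1
    rw [h1, map_eq_zero, ← coe_aeval_eq_eval]
    rfl
  rcases eq_or_ne w [] with rfl | hw0
  · -- the empty word needs no addition
    have hγ0 : γ = 0 := by simp [hγ, expansion]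
    refine ⟨{t | ∃ f ∈ Q, t = C h * f}, ?_, fun x v hxv => ?_⟩
    · rintro _ ⟨f, hf, rfl⟩
      refine ⟨fun β => ?_, ?_⟩
      · rw [coeff_C_mul]
        refine boxSpan_mono ?_ ((hQ f hf).2 β)
        refine le_trans ?_ (Nat.le_mul_of_pos_right _ hQ1)
        rw [heightBound]
        omega
      · refine (totalDegree_mul _ _).trans ?_
        rw [totalDegree_C, zero_add]
        exact (hQ f hf).1.trans (Nat.le_add_right _ _)
    · rw [hγ0, add_zero, hX.2]
      have hFx := G.hasCoords_frob_iterate hxv (l * r)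
      have h1 : ∀ f ∈ Q, (VanishesAt f (G.frob^[l * r] x).1 ↔
          eval (fun i => v i ^ q ^ (l * r)) (C h * f) = 0) := by
        intro f hf
        obtain ⟨d, hd⟩ := hX.1 f hf
        rw [hFx.vanishesAt_iff hd, hevU, map_mul, eval_C, mul_eq_zero, or_iff_right hh]
      constructor
      · rintro hx _ ⟨f, hf, rfl⟩
        exact (h1 f hf).1 (hx f hf)
      · exact fun hx f hf => (h1 f hf).2 (hx _ ⟨f, hf, rfl⟩)
  · obtain ⟨u, hu, H, hH, huH⟩ := exists_hasCoords_expansion G hr hdeg hh hcoord hS w hwS hw0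
    have huL : ∀ i, u i ∈ boxSpan p c (2 * q ^ r * M * q ^ (l * r)) := by
      refine fun i => boxSpan_mono ?_ (huH i)
      refine (Nat.le_add_right _ _).trans (hH.trans (Nat.mul_le_mul_left _ ?_))
      rw [← pow_mul, mul_comm r]
      exact Nat.pow_le_pow_right Fintype.card_pos (Nat.mul_le_mul_right _ hwl)
    refine ⟨{t | ∃ b ∈ G.law, ∃ g ∈ b.opens, ∃ f ∈ Q, t = translatePoly h u g b.coord f}, ?_,
      fun x v hxv => ?_⟩
    · rintro _ ⟨b, hb, g, hg, f, hf, rfl⟩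
      refine ⟨fun β => ?_, totalDegree_translatePoly_le h u (hopens b hb g hg).1 (hdeg b hb)
        (hQ f hf).1⟩
      refine boxSpan_mono ?_ (translatePoly_mem_coeffFil huL (hopens b hb g hg).2
        (hopens b hb g hg).1 (hcoord b hb) (hdeg b hb) (hQ f hf).2 (hQ f hf).1 β)
      set T := q ^ (l * r) with hT
      have h1 : ∀ a, a ≤ a * T := fun a => Nat.le_mul_of_pos_right _ hQ1
      calc _ = M + M * (2 * q ^ r * M) * T + (M + M * M + M * (q ^ r * (2 * q ^ r * M)) * T) := by
            ring
        _ ≤ M * T + M * (2 * q ^ r * M) * T +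
            (M * T + M * M * T + M * (q ^ r * (2 * q ^ r * M)) * T) := by
            have := h1 M
            have := h1 (M * M)
            omega
        _ = _ := by
            rw [heightBound]
            ring
    · have hFx := G.hasCoords_frob_iterate hxv (l * r)
      rw [G.add_mem_iff hX hFx hu ((map_ne_zero (algebraMap K U)).2 hh)]
      have h1 : ∀ (b : BiChart k n) g (f : MvPolynomial (Fin (n + 1)) K),
          aeval (fun i => algebraMap K U (v i) ^ q ^ (l * r))
            (translatePoly (algebraMap K U h) (fun i => algebraMap K U (u i)) g b.coord f) = 0 ↔
          eval (fun i => v i ^ q ^ (l * r)) (translatePoly h u g b.coord f) = 0 := by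
        intro b g f
        rw [← hevU, aeval_translatePoly, aeval_translatePoly]
        simp only [Algebra.algebraMap_self, RingHom.id_apply]
      constructor
      · rintro hx _ ⟨b, hb, g, hg, f, hf, rfl⟩
        exact (h1 b g f).1 (hx b hb g hg f hf)
      · exact fun hx b hb g hg f hf => (h1 b g f).2 (hx _ ⟨b, hb, g, hg, f, hf, rfl⟩)

/-- The finiteness theorem with an explicit bound in terms of the size `M` of the data. -/
theorem finite_pullbackSets (G : CommAlgGroup k U n) {X S : Set G.Pts} {r : ℕ}
    (hgen : ∀ x : K, ∃ g h : MvPolynomial (Fin s) (ZMod p), x = aeval c g / aeval c h)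
    (Rel : Set (MvPolynomial (Fin s) (ZMod p)))
    (hrel : RingHom.ker (aeval c : MvPolynomial (Fin s) (ZMod p) →ₐ[ZMod p] K) = Ideal.span Rel)
    {M : ℕ} (hRel : ∀ f ∈ Rel, f ∈ boxSpan p MvPolynomial.X M)
    (hr : 0 < r)
    (hdeg : ∀ b ∈ G.law, ∀ i, (b.coord i).totalDegree ≤ Fintype.card k ^ r) {h : K} (hh : h ≠ 0)
    (hcoord : ∀ b ∈ G.law, ∀ i β,
      h * algebraMap k K ((b.coord i).coeff β) ∈ boxSpan p c M)
    (hopens : ∀ b ∈ G.law, ∀ g ∈ b.opens, g.totalDegree ≤ M ∧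
      ∀ β, h * algebraMap k K (g.coeff β) ∈ boxSpan p c M)
    {Q : List (MvPolynomial (Fin (n + 1)) K)} (hX : G.IsDefinedBy X Q)
    (hQ : ∀ f ∈ Q, f.totalDegree ≤ M ∧ ∀ β, h * f.coeff β ∈ boxSpan p c M)
    (hS : ∀ x ∈ S, ∃ u : Fin (n + 1) → K, HasCoords x.1 (fun i => algebraMap K U (u i)) ∧
      ∀ i, u i ∈ boxSpan p c M) :
    (G.pullbackSets K X S r).Finite ∧ (G.pullbackSets K X S r).ncard ≤
      rootSetsBound p s M (heightBound M (Fintype.card k ^ r)) (M + M * Fintype.card k ^ r)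
        (n + 1) := by
  have hsub := pullbackSets_subset_image_rootSets G hr hdeg hh hcoord hopens hX hQ hS
  obtain ⟨hfin, hcard⟩ := finite_rootSets c hgen Rel hrel hRel
    (heightBound M (Fintype.card k ^ r)) (M + M * Fintype.card k ^ r) (n + 1)
  exact ⟨(hfin.image _).subset hsub, (Set.ncard_le_ncard hsub (hfin.image _)).trans
    ((Set.ncard_image_le hfin).trans hcard)⟩

end Core

/-! ### Codes and common denominators -/

section Encode

theorem encode_lt_encode_of_mem {α : Type*} [Encodable α] {x : α} {l : List α} (h : x ∈ l) :
    Encodable.encode x < Encodable.encode l := by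
  induction l with
  | nil => simp at h
  | cons a l ih =>
    rw [Encodable.encode_list_cons, Nat.lt_succ_iff]
    rcases List.mem_cons.1 h with rfl | h
    · exact Nat.left_le_pair _ _
    · exact (ih h).le.trans (Nat.right_le_pair _ _)

theorem encode_fst_le {α β : Type*} [Encodable α] [Encodable β] (x : α × β) :
    Encodable.encode x.1 ≤ Encodable.encode x := by
  obtain ⟨a, b⟩ := x
  exact Nat.left_le_pair _ _

theorem encode_snd_le {α β : Type*} [Encodable α] [Encodable β] (x : α × β) :
    Encodable.encode x.2 ≤ Encodable.encode x := by
  obtain ⟨a, b⟩ := x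
  exact Nat.right_le_pair _ _

theorem getD_le_encode (l : List ℕ) (i : ℕ) : l.getD i 0 ≤ Encodable.encode l := by
  rcases lt_or_ge i l.length with h | h
  · rw [List.getD_eq_getElem _ _ h]
    exact (encode_lt_encode_of_mem (List.getElem_mem h)).le
  · rw [List.getD_eq_default _ _ h]
    exact Nat.zero_le _

end Encode

section CommonDenominator

variable {p : ℕ} {K : Type*} [Field K] [Algebra (ZMod p) K] {s : ℕ}

/-- The elements of `V` have a common denominator of size at most `N` such that the numerators
have size at most `N` as well. -/
def HasCommonDenominator (p : ℕ) {K : Type*} [Field K] [Algebra (ZMod p) K] {s : ℕ}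
    (c : Fin s → K) (V : Set K) (N : ℕ) : Prop :=
  ∃ h ∈ boxSpan p c N, h ≠ 0 ∧ ∀ x ∈ V, h * x ∈ boxSpan p c N

variable {c : Fin s → K}

theorem hasCommonDenominator_empty (N : ℕ) : HasCommonDenominator p c ∅ N :=
  ⟨1, one_mem_boxSpan, one_ne_zero, by simp⟩

theorem HasCommonDenominator.mono {V : Set K} {M N : ℕ} (h : HasCommonDenominator p c V M)
    (hMN : M ≤ N) : HasCommonDenominator p c V N := by
  obtain ⟨d, hd, hd0, hV⟩ := h
  exact ⟨d, boxSpan_mono hMN hd, hd0, fun x hx => boxSpan_mono hMN (hV x hx)⟩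

theorem HasCommonDenominator.union {V W : Set K} {M N : ℕ} (hV : HasCommonDenominator p c V M)
    (hW : HasCommonDenominator p c W N) : HasCommonDenominator p c (V ∪ W) (M + N) := by
  obtain ⟨d, hd, hd0, hV⟩ := hV
  obtain ⟨e, he, he0, hW⟩ := hW
  refine ⟨d * e, mul_mem_boxSpan hd he, mul_ne_zero hd0 he0, fun x hx => ?_⟩
  rcases hx with hx | hx
  · rw [mul_right_comm]
    exact mul_mem_boxSpan (hV x hx) he
  · rw [mul_assoc]
    exact mul_mem_boxSpan hd (hW x hx)

theorem hasCommonDenominator_list {α : Type*} [Encodable α] (V : α → Set K)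
    (h : ∀ x, HasCommonDenominator p c (V x) (Encodable.encode x)) (l : List α) :
    HasCommonDenominator p c (⋃ x ∈ l, V x) (Encodable.encode l) := by
  induction l with
  | nil => simpa using hasCommonDenominator_empty _
  | cons a l ih =>
    have h1 : (⋃ x ∈ a :: l, V x) = V a ∪ ⋃ x ∈ l, V x := by
      ext y
      simp
    rw [h1, Encodable.encode_list_cons]
    exact ((h a).union ih).mono ((Nat.add_le_pair _ _).trans (Nat.le_succ _))

theorem hasCommonDenominator_of_finite
    (hgen : ∀ x : K, ∃ g h : MvPolynomial (Fin s) (ZMod p), x = aeval c g / aeval c h)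
    {V : Set K} (hV : V.Finite) : ∃ N, HasCommonDenominator p c V N := by
  induction V, hV using Set.Finite.induction_on with
  | empty => exact ⟨0, hasCommonDenominator_empty 0⟩
  | @insert a V _ _ ih =>
    obtain ⟨N, hN⟩ := ih
    have hbox : ∀ g : MvPolynomial (Fin s) (ZMod p), aeval c g ∈ boxSpan p c g.totalDegree :=
      fun g => aeval_mem_boxSpan g fun β hβ i =>
        (Finset.single_le_sum (fun _ _ => Nat.zero_le _) (Finset.mem_univ i)).trans
          (sum_le_of_mem_support hβ)
    have ha : ∃ M, HasCommonDenominator p c {a} M := by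
      obtain ⟨g, h, rfl⟩ := hgen a
      by_cases h0 : aeval c h = 0
      · refine ⟨0, 1, one_mem_boxSpan, one_ne_zero, ?_⟩
        simp [h0]
      · refine ⟨max g.totalDegree h.totalDegree, aeval c h, boxSpan_mono (le_max_right _ _) (hbox h),
          h0, ?_⟩
        rintro _ rfl
        rw [mul_div_cancel₀ _ h0]
        exact boxSpan_mono (le_max_left _ _) (hbox g)
    obtain ⟨M, hM⟩ := ha
    exact ⟨M + N, hM.union hN⟩

end CommonDenominator

section Codes

variable {p : ℕ} {K : Type*} [Field K] [Algebra (ZMod p) K] {s : ℕ} {c : Fin s → K}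

theorem decodeTerms_mem {C R σ : Type*} [CommSemiring R] [Finite σ] {val : C → R} {pos : σ → ℕ}
    {L : List (C × List ℕ)} (P : AddSubmonoid (MvPolynomial σ R))
    (h : ∀ t ∈ L, monomial (Finsupp.equivFunOnFinite.symm fun i => t.2.getD (pos i) 0) (val t.1)
      ∈ P) : decodeTerms val pos L ∈ P := by
  refine AddSubmonoid.list_sum_mem _ fun x hx => ?_
  obtain ⟨t, ht, rfl⟩ := List.mem_map.1 hx
  exact h t ht

theorem toPoly_mem_boxSpan (t : PolyCode) :
    PolyCode.toPoly p s t ∈ boxSpan p (X : Fin s → MvPolynomial (Fin s) (ZMod p))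
      (Encodable.encode t) := by
  let P : AddSubmonoid (MvPolynomial (Fin s) (ZMod p)) :=
    (boxSpan p (X : Fin s → MvPolynomial (Fin s) (ZMod p)) (Encodable.encode t)).toAddSubmonoid
  refine decodeTerms_mem P fun u hu => ?_
  rw [monomial_eq, Finsupp.prod_fintype _ _ (by simp), ← algebraMap_eq, ← Algebra.smul_def]
  refine Submodule.smul_mem (boxSpan p _ _) _ (monomial_mem_boxSpan _ fun i => ?_)
  exact (getD_le_encode _ _).trans ((encode_snd_le u).trans (encode_lt_encode_of_mem hu).le)

theorem aeval_toPoly_mem_boxSpan (t : PolyCode) :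
    aeval c (PolyCode.toPoly p s t) ∈ boxSpan p c (Encodable.encode t) := by
  have h := map_boxSpan (p := p) (c := X) (aeval c : MvPolynomial (Fin s) (ZMod p) →ₐ[ZMod p] K)
    (Encodable.encode t)
  simp only [aeval_X] at h
  rw [← h]
  exact Submodule.mem_map_of_mem (toPoly_mem_boxSpan t)

/-- The set containing the value of a code of an element of `K`, if this code is valid. -/
def fracValues (p : ℕ) {K : Type*} [Field K] [Algebra (ZMod p) K] {s : ℕ} (c : Fin s → K)
    (a : FracCode) : Set K :=
  {x | FracCode.Valid p c a ∧ x = FracCode.value p c a}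

theorem hasCommonDenominator_fracValues (a : FracCode) :
    HasCommonDenominator p c (fracValues p c a) (Encodable.encode a) := by
  by_cases h : FracCode.Valid p c a
  · refine ⟨_, boxSpan_mono (encode_snd_le a) (aeval_toPoly_mem_boxSpan a.2), h, ?_⟩
    rintro x ⟨-, rfl⟩
    rw [FracCode.value, mul_div_cancel₀ _ h]
    exact boxSpan_mono (encode_fst_le a) (aeval_toPoly_mem_boxSpan a.1)
  · refine ⟨1, one_mem_boxSpan, one_ne_zero, ?_⟩
    rintro x ⟨hx, -⟩
    exact absurd hx h

/-- The values of the coefficients of a code of a polynomial over `K`. -/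
def kpolyValues (p : ℕ) {K : Type*} [Field K] [Algebra (ZMod p) K] {s : ℕ} (c : Fin s → K)
    (t : KPolyCode) : Set K :=
  ⋃ u ∈ t, fracValues p c u.1

theorem hasCommonDenominator_kpolyValues (t : KPolyCode) :
    HasCommonDenominator p c (kpolyValues p c t) (Encodable.encode t) :=
  hasCommonDenominator_list (fun u : FracCode × List ℕ => fracValues p c u.1)
    (fun u => (hasCommonDenominator_fracValues u.1).mono (encode_fst_le u)) t

/-- The values of the coefficients of a code of a chart. -/
def chartValues (p : ℕ) {K : Type*} [Field K] [Algebra (ZMod p) K] {s : ℕ} (c : Fin s → K)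
    (t : List KPolyCode × List KPolyCode) : Set K :=
  (⋃ u ∈ t.1, kpolyValues p c u) ∪ ⋃ u ∈ t.2, kpolyValues p c u

theorem hasCommonDenominator_chartValues (t : List KPolyCode × List KPolyCode) :
    HasCommonDenominator p c (chartValues p c t) (Encodable.encode t) :=
  ((hasCommonDenominator_list _ hasCommonDenominator_kpolyValues t.1).union
    (hasCommonDenominator_list _ hasCommonDenominator_kpolyValues t.2)).mono
    (Nat.add_le_pair _ _)

/-- The values of the elements of `K` that occur in the codes of the group law, of the subvariety
and of the points. -/
def InputCode.values (p : ℕ) {K : Type*} [Field K] [Algebra (ZMod p) K] (D : InputCode)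
    (c : Fin D.s → K) : Set K :=
  (⋃ t ∈ D.law, chartValues p c t) ∪
    ((⋃ t ∈ D.sub, kpolyValues p c t) ∪ ⋃ t ∈ D.pts, ⋃ a ∈ t, fracValues p c a)

theorem InputCode.hasCommonDenominator (D : InputCode) (c : Fin D.s → K) :
    HasCommonDenominator p c (D.values p c) (Encodable.encode D.toTuple) := by
  have h1 := hasCommonDenominator_list _ (hasCommonDenominator_chartValues (p := p) (c := c)) D.law
  have h2 := hasCommonDenominator_list _ (hasCommonDenominator_kpolyValues (p := p) (c := c)) D.sub
  have h3 := hasCommonDenominator_list _ (hasCommonDenominator_list _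
    (hasCommonDenominator_fracValues (p := p) (c := c))) D.pts
  refine (h1.union (h2.union h3)).mono ?_
  refine le_trans ?_ (encode_snd_le D.toTuple)
  refine le_trans ?_ (encode_snd_le D.toTuple.2)
  refine le_trans ?_ (encode_snd_le D.toTuple.2.2)
  refine le_trans ?_ (encode_snd_le D.toTuple.2.2.2)
  exact (Nat.add_le_add_left (Nat.add_le_pair _ _) _).trans (Nat.add_le_pair _ _)

theorem KPolyCode.Codes.mul_coeff_mem {σ : Type*} [Finite σ] {pos : σ → ℕ} {t : KPolyCode}
    {f : MvPolynomial σ K} (hf : KPolyCode.Codes p c pos t f) {h : K} {N : ℕ}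
    (hN : ∀ x ∈ kpolyValues p c t, h * x ∈ boxSpan p c N) (β : σ →₀ ℕ) :
    h * f.coeff β ∈ boxSpan p c N := by
  classical
  have h1 : f ∈ (coeffFil p c σ N).comap (AddMonoidHom.mulLeft (C h)) := by
    rw [← hf.2]
    refine decodeTerms_mem _ fun u hu => ?_
    intro β
    rw [AddMonoidHom.coe_mulLeft, coeff_C_mul, coeff_monomial]
    split_ifs
    · exact hN _ (Set.mem_biUnion hu ⟨hf.1 u hu, rfl⟩)
    · rw [mul_zero]
      exact zero_mem _
  have h2 := h1 β
  rwa [AddMonoidHom.coe_mulLeft, coeff_C_mul] at h2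

theorem KPolyCode.Codes.totalDegree_le {σ : Type*} [Fintype σ] {pos : σ → ℕ} {t : KPolyCode}
    {f : MvPolynomial σ K} (hf : KPolyCode.Codes p c pos t f) :
    f.totalDegree ≤ Fintype.card σ * Encodable.encode t := by
  have h1 : f ∈ degreeFil K σ (Fintype.card σ * Encodable.encode t) := by
    rw [← hf.2]
    refine decodeTerms_mem _ fun u hu => ?_
    refine (totalDegree_monomial_le _ _).trans ?_
    rw [Finsupp.sum_fintype _ _ (by simp), ← smul_eq_mul, ← Finset.card_univ]
    refine Finset.sum_le_card_nsmul _ _ _ fun i _ => ?_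
    exact (getD_le_encode _ _).trans ((encode_snd_le u).trans (encode_lt_encode_of_mem hu).le)
  exact h1

end Codes

/-! ### The computable bound -/

section Bound

theorem primrec_pow : Primrec₂ fun a b : ℕ => a ^ b := by
  have h := Primrec.nat_rec (f := fun _ : ℕ => 1) (g := fun (a : ℕ) (x : ℕ × ℕ) => x.2 * a)
    (Primrec.const 1) (Primrec.nat_mul.comp (Primrec.snd.comp Primrec.snd) Primrec.fst)
  refine h.of_eq fun a b => ?_
  induction b with
  | zero => rfl
  | succ b ih => rw [pow_succ, ← ih]

/-- The bound for the number of sets in terms of the number `m` bounding all sizes. -/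
def sizeBound (m : ℕ) : ℕ :=
  rootSetsBound m m m (heightBound m (m ^ m)) (m + m * m ^ m) (m + 1)

theorem primrec_sizeBound : Primrec sizeBound := by
  have hadd : ∀ {f g : ℕ → ℕ}, Primrec f → Primrec g → Primrec fun m => f m + g m :=
    fun hf hg => Primrec.nat_add.comp hf hg
  have hmul : ∀ {f g : ℕ → ℕ}, Primrec f → Primrec g → Primrec fun m => f m * g m :=
    fun hf hg => Primrec.nat_mul.comp hf hg
  have hpow : ∀ {f g : ℕ → ℕ}, Primrec f → Primrec g → Primrec fun m => f m ^ g m :=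
    fun hf hg => primrec_pow.comp hf hg
  have hc : ∀ a : ℕ, Primrec fun _ : ℕ => a := Primrec.const
  have hid : Primrec fun m : ℕ => m := Primrec.id
  have hQ := hpow hid hid
  have hA : Primrec fun m : ℕ => heightBound m (m ^ m) :=
    hadd (hadd hid (hmul hid (hmul (hmul (hc 2) hQ) hid)))
      (hadd hid (hmul hid (hadd hid (hmul hQ (hmul (hmul (hc 2) hQ) hid)))))
  have hN : Primrec fun m : ℕ => structureBound m m m :=
    hmul (hpow hid hid) (hpow hid (hmul (hpow (hadd (hmul hid hid) (hc 1)) hid) (hpow hid hid)))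
  exact hpow (hc 2) (hpow (hpow hid (hpow (hadd (hadd hA (hmul (hc 4) hN)) (hc 1)) hid))
    (hpow (hadd (hadd hid (hmul hid hQ)) (hc 1)) (hadd hid (hc 1))))

theorem rootSetsBound_le_sizeBound {p s Q n m : ℕ} (hp0 : 1 ≤ p) (hp : p ≤ m) (hs : s ≤ m)
    (hQ : Q ≤ m ^ m) (hn : n ≤ m) :
    rootSetsBound p s m (heightBound m Q) (m + m * Q) (n + 1) ≤ sizeBound m := by
  have hm : 1 ≤ m := hp0.trans hp
  have hpow : ∀ {a b i j : ℕ}, 1 ≤ b → a ≤ b → i ≤ j → a ^ i ≤ b ^ j := fun hb hab hij =>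
    (Nat.pow_le_pow_left hab _).trans (Nat.pow_le_pow_right hb hij)
  have hN : structureBound p s m ≤ structureBound m m m := by
    unfold structureBound
    refine Nat.mul_le_mul (hpow hm hp hs) (hpow hm hp (Nat.mul_le_mul ?_ (hpow hm hp hs)))
    exact hpow (by omega) (Nat.add_le_add_right (Nat.mul_le_mul_right _ hs) _) hs
  have hA : heightBound m Q ≤ heightBound m (m ^ m) := by
    unfold heightBound
    gcongr
  unfold sizeBound rootSetsBound
  refine Nat.pow_le_pow_right two_pos (hpow (Nat.one_le_pow _ _ hm) (hpow hm hp (hpow ?_ ?_ hs))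
    (hpow ?_ ?_ ?_))
  · omega
  · omega
  · omega
  · gcongr
  · omega

end Bound

section Presentation

theorem totalDegree_le_totalDegree_map {σ k K : Type*} [Field k] [Field K] (φ : k →+* K)
    (g : MvPolynomial σ k) : g.totalDegree ≤ (map φ g).totalDegree := by
  rw [totalDegree, totalDegree, support_map_of_injective g φ.injective]

theorem exists_mem_left_of_forall₂ {α β : Type*} {R : α → β → Prop} {l : List α} {l' : List β}
    (h : List.Forall₂ R l l') {b : β} (hb : b ∈ l') : ∃ a ∈ l, R a b := by
  induction h with
  | nil => simp at hb
  | cons hab _ ih =>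
    rcases List.mem_cons.1 hb with rfl | hb
    · exact ⟨_, List.mem_cons_self, hab⟩
    · obtain ⟨a, ha, hr⟩ := ih hb
      exact ⟨a, List.mem_cons_of_mem _ ha, hr⟩

variable {p : ℕ} [Fact p.Prime] {k K U : Type*} [Field k] [Fintype k] [Field K] [Field U]
  [IsAlgClosed U] [Algebra k K] [Algebra k U] [Algebra K U] [IsScalarTower k K U]
  [Algebra (ZMod p) K] {n : ℕ}

theorem exists_eq_div_of_adjoin_eq_top {s : ℕ} {c : Fin s → K}
    (h : IntermediateField.adjoin (ZMod p) (Set.range c) = ⊤) (x : K) :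
    ∃ g h : MvPolynomial (Fin s) (ZMod p), x = aeval c g / aeval c h :=
  (IntermediateField.mem_adjoin_range_iff (F := ZMod p) c x).1 (h ▸ IntermediateField.mem_top)

/-- A field that is finitely generated over a finite field is finitely generated over the prime
field. -/
theorem exists_generators {k' : Type*} [Field k'] [Finite k'] [Algebra k' K]
    (h : (⊤ : IntermediateField k' K).FG) :
    ∃ (s : ℕ) (c : Fin s → K), IntermediateField.adjoin (ZMod p) (Set.range c) = ⊤ := by
  obtain ⟨T, hT⟩ := h
  obtain ⟨s, c, hc⟩ :=
    (T.finite_toSet.union (Set.finite_range (algebraMap k' K))).fin_embedding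
  refine ⟨s, c, ?_⟩
  rw [hc, eq_top_iff]
  intro x _
  have hx : x ∈ IntermediateField.adjoin k' (T : Set K) := hT ▸ IntermediateField.mem_top
  induction hx using IntermediateField.adjoin_induction with
  | mem x hx => exact IntermediateField.subset_adjoin _ _ (Or.inl hx)
  | algebraMap x => exact IntermediateField.subset_adjoin _ _ (Or.inr ⟨x, rfl⟩)
  | add x y _ _ hx hy => exact add_mem (hx trivial) (hy trivial)
  | inv x _ hx => exact inv_mem (hx trivial)
  | mul x y _ _ hx hy => exact mul_mem (hx trivial) (hy trivial)

/-- Finiteness: any choice of a presentation of the data makes the explicit bound available. -/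
theorem finite_pullbackSets_of_fg {k' : Type*} [Field k'] [Finite k'] [Algebra k' K]
    (hK : (⊤ : IntermediateField k' K).FG) (p : ℕ) [Fact p.Prime] [Algebra (ZMod p) K]
    (G : CommAlgGroup k U n) {X S : Set G.Pts} {r : ℕ} (hr : 0 < r)
    (hdeg : ∀ b ∈ G.law, ∀ i, (b.coord i).totalDegree ≤ Fintype.card k ^ r)
    (hX : G.IsClosedSubvariety K X) (hSfin : S.Finite) (hS : ∀ x ∈ S, IsRationalPt K x.1) :
    (G.pullbackSets K X S r).Finite := by
  classical
  obtain ⟨s, c, hc⟩ := exists_generators (p := p) hK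
  have hgen := exists_eq_div_of_adjoin_eq_top hc
  obtain ⟨Q, hQ⟩ := hX
  obtain ⟨Rel, hRel⟩ := (inferInstance : IsNoetherianRing (MvPolynomial (Fin s) (ZMod p))).noetherian
    (RingHom.ker (aeval c : MvPolynomial (Fin s) (ZMod p) →ₐ[ZMod p] K))
  have hS' : ∀ x : S, ∃ u : Fin (n + 1) → K,
      HasCoords x.1.1 fun i => algebraMap K U (u i) :=
    fun x => (isRationalPt_iff_exists_hasCoords _).1 (hS x x.2)
  choose u hu using hS'
  have hcoeff : ∀ (σ : Type) (g : MvPolynomial σ K), (Set.range fun β => g.coeff β).Finite := by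
    intro σ g
    refine ((g.support.finite_toSet.image fun β => g.coeff β).union
      (Set.finite_singleton 0)).subset ?_
    rintro _ ⟨β, rfl⟩
    by_cases hβ : β ∈ g.support
    · exact Or.inl ⟨β, hβ, rfl⟩
    · exact Or.inr (notMem_support_iff.1 hβ)
  have : Finite S := hSfin.to_subtype
  let polys : Set (MvPolynomial (Fin (n + 1) ⊕ Fin (n + 1)) k) :=
    ⋃ b ∈ {b | b ∈ G.law}, {g | g ∈ b.opens} ∪ Set.range b.coord
  have hpolys : polys.Finite := (List.finite_toSet G.law).biUnion fun b _ =>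
    (List.finite_toSet b.opens).union (Set.finite_range _)
  have hVfin : ((⋃ g ∈ polys, Set.range fun β => (map (algebraMap k K) g).coeff β) ∪
      ((⋃ f ∈ {f | f ∈ Q}, Set.range fun β => f.coeff β) ∪ ⋃ x : S, Set.range (u x))).Finite :=
    (hpolys.biUnion fun g _ => hcoeff _ _).union
      (((List.finite_toSet Q).biUnion fun f _ => hcoeff _ _).union
        (Set.finite_iUnion fun x => Set.finite_range _))
  obtain ⟨N₁, h, -, hh, hV⟩ := hasCommonDenominator_of_finite hgen hVfin
  obtain ⟨N₂, hN₂⟩ := (hpolys.image totalDegree).bddAbove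
  obtain ⟨N₃, hN₃⟩ := ((List.finite_toSet Q).image totalDegree).bddAbove
  obtain ⟨N₄, hN₄⟩ := (Rel.finite_toSet.image totalDegree).bddAbove
  set M := N₁ + N₂ + N₃ + N₄ with hM
  have hmono : boxSpan p c N₁ ≤ boxSpan p c M := boxSpan_mono (by omega)
  have hmem : ∀ b ∈ G.law, ∀ g, g ∈ b.opens ∨ g ∈ Set.range b.coord → g ∈ polys :=
    fun b hb g hg => Set.mem_biUnion (show b ∈ {b | b ∈ G.law} from hb) hg
  have hlaw : ∀ g ∈ polys, ∀ β, h * algebraMap k K (g.coeff β) ∈ boxSpan p c M := by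
    intro g hg β
    rw [← coeff_map]
    exact hmono (hV _ (Or.inl (Set.mem_biUnion hg ⟨β, rfl⟩)))
  refine (finite_pullbackSets (c := c) (M := M) G hgen Rel hRel.symm (fun f hf => ?_) hr hdeg hh
    (fun b hb i β => hlaw _ (hmem b hb _ (Or.inr ⟨i, rfl⟩)) β)
    (fun b hb g hg => ⟨?_, hlaw _ (hmem b hb _ (Or.inl hg))⟩) hQ (fun f hf => ⟨?_, fun β => ?_⟩)
    (fun x hx => ?_)).1
  · have h1 : f.totalDegree ≤ N₄ := hN₄ ⟨f, hf, rfl⟩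
    have h2 := aeval_mem_boxSpan (c := (MvPolynomial.X : Fin s → MvPolynomial (Fin s) (ZMod p))) (N := M) f
      fun β hβ i => (Finset.single_le_sum (fun _ _ => Nat.zero_le _) (Finset.mem_univ i)).trans
        ((sum_le_of_mem_support hβ).trans (by omega))
    rwa [aeval_X_left_apply] at h2
  · have h1 : g.totalDegree ≤ N₂ := hN₂ ⟨g, hmem b hb _ (Or.inl hg), rfl⟩
    omega
  · have h1 : f.totalDegree ≤ N₃ := hN₃ ⟨f, hf, rfl⟩
    omega
  · exact hmono (hV _ (Or.inr (Or.inl (Set.mem_biUnion (show f ∈ {f | f ∈ Q} from hf) ⟨β, rfl⟩))))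
  · refine ⟨h • u ⟨x, hx⟩, ?_, fun i =>
      hmono (hV _ (Or.inr (Or.inr (Set.mem_iUnion.2 ⟨⟨x, hx⟩, i, rfl⟩))))⟩
    have h1 := (hu ⟨x, hx⟩).smul ((map_ne_zero (algebraMap K U)).2 hh)
    convert h1 using 1
    funext i
    exact map_mul _ _ _

/-- The number bounding all sizes in a presentation. -/
def InputCode.size (D : InputCode) : ℕ := 2 * (Encodable.encode D.toTuple + 1) ^ 2

theorem ncard_pullbackSets_le (G : CommAlgGroup k U n) {X S : Set G.Pts} {r : ℕ} (hr : 0 < r)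
    (hdeg : ∀ b ∈ G.law, ∀ i, (b.coord i).totalDegree ≤ Fintype.card k ^ r)
    (D : InputCode) (c : Fin D.s → K) (hD : D.Presents p c G X S r) :
    (G.pullbackSets K X S r).ncard ≤ sizeBound D.size := by
  set E := Encodable.encode D.toTuple with hE
  set M := D.size with hM
  have hME : M = 2 * (E + 1) ^ 2 := rfl
  have hEM : E ≤ M := by nlinarith
  obtain ⟨h, -, hh, hV⟩ := D.hasCommonDenominator (p := p) c
  have hmono : boxSpan p c E ≤ boxSpan p c M := boxSpan_mono hEM
  -- the components of the presentation are bounded by its code number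
  have e1 : Encodable.encode D.toTuple.1 ≤ E := encode_fst_le _
  have e2 : Encodable.encode D.toTuple.2 ≤ E := encode_snd_le _
  have hp : D.p ≤ E := (encode_fst_le D.toTuple.1).trans e1
  have e12 : Encodable.encode D.toTuple.1.2 ≤ E := (encode_snd_le _).trans e1
  have hq : D.q ≤ E := (encode_fst_le D.toTuple.1.2).trans e12
  have e13 : Encodable.encode D.toTuple.1.2.2 ≤ E := (encode_snd_le _).trans e12
  have hr' : D.r ≤ E := (encode_fst_le D.toTuple.1.2.2).trans e13
  have e14 : Encodable.encode D.toTuple.1.2.2.2 ≤ E := (encode_snd_le _).trans e13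
  have hn : D.n ≤ E := (encode_fst_le D.toTuple.1.2.2.2).trans e14
  have hs : D.s ≤ E := (encode_snd_le D.toTuple.1.2.2.2).trans e14
  have hrels : Encodable.encode D.rels ≤ E := (encode_fst_le D.toTuple.2).trans e2
  have e22 : Encodable.encode D.toTuple.2.2.2.2 ≤ E :=
    (encode_snd_le D.toTuple.2.2.2).trans ((encode_snd_le D.toTuple.2.2).trans
      ((encode_snd_le D.toTuple.2).trans e2))
  have hlaw : Encodable.encode D.law ≤ E := (encode_fst_le D.toTuple.2.2.2.2).trans e22
  have hsub : Encodable.encode D.sub ≤ E :=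
    (encode_fst_le D.toTuple.2.2.2.2.2).trans ((encode_snd_le _).trans e22)
  have hdegree : ∀ {σ : Type} [Fintype σ] {pos : σ → ℕ} {t : KPolyCode} {f : MvPolynomial σ K},
      KPolyCode.Codes p c pos t f → Fintype.card σ ≤ 2 * (n + 1) → Encodable.encode t ≤ E →
      f.totalDegree ≤ M := by
    intro σ _ pos t f hf hσ ht
    rw [hD.n_eq] at hn
    calc f.totalDegree ≤ Fintype.card σ * Encodable.encode t := hf.totalDegree_le
      _ ≤ (2 * (E + 1)) * (E + 1) := Nat.mul_le_mul (by omega) (by omega)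
      _ = M := by rw [hME]; ring
  have hchart : ∀ b ∈ G.law, ∃ t ∈ D.law, CodesChart p c t b :=
    fun b hb => exists_mem_left_of_forall₂ hD.law hb
  have hcoeff : ∀ {σ : Type} [Finite σ] {pos : σ → ℕ} {t : KPolyCode} {f : MvPolynomial σ K},
      KPolyCode.Codes p c pos t f → kpolyValues p c t ⊆ D.values p c →
      ∀ β, h * f.coeff β ∈ boxSpan p c M :=
    fun hf ht β => hmono (hf.mul_coeff_mem (fun x hx => hV x (ht hx)) β)
  have hsubset : ∀ t ∈ D.law, chartValues p c t ⊆ D.values p c :=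
    fun t ht x hx => Or.inl (Set.mem_biUnion ht hx)
  obtain ⟨Q, hQ, hQc⟩ := hD.sub
  refine ((finite_pullbackSets (c := c) (M := M) G
    (exists_eq_div_of_adjoin_eq_top hD.generate) _ hD.relations ?_ hr hdeg hh ?_ ?_ hQ ?_
    ?_).2).trans (rootSetsBound_le_sizeBound (Nat.Prime.one_le Fact.out) ?_ (hs.trans hEM) ?_ ?_)
  · rintro _ ⟨t, ht, rfl⟩
    exact boxSpan_mono ((encode_lt_encode_of_mem ht).le.trans (hrels.trans hEM))
      (toPoly_mem_boxSpan t)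
  · intro b hb i β
    obtain ⟨t, ht, -, hb2⟩ := hchart b hb
    obtain ⟨v, hv, hvc⟩ := exists_mem_left_of_forall₂ hb2 (List.mem_ofFn.2 ⟨i, rfl⟩)
    rw [← coeff_map]
    exact hcoeff hvc (fun x hx => hsubset t ht (Or.inr (Set.mem_biUnion hv hx))) β
  · intro b hb g hg
    obtain ⟨t, ht, hb1, -⟩ := hchart b hb
    obtain ⟨v, hv, hvc⟩ := exists_mem_left_of_forall₂ hb1 hg
    refine ⟨(totalDegree_le_totalDegree_map (algebraMap k K) g).trans (hdegree hvc ?_ ?_),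
      fun β => ?_⟩
    · rw [Fintype.card_sum, Fintype.card_fin]
      omega
    · exact (encode_lt_encode_of_mem hv).le.trans ((encode_fst_le t).trans
        ((encode_lt_encode_of_mem ht).le.trans hlaw))
    · rw [← coeff_map]
      exact hcoeff hvc (fun x hx => hsubset t ht (Or.inl (Set.mem_biUnion hv hx))) β
  · intro f hf
    obtain ⟨t, ht, hfc⟩ := exists_mem_left_of_forall₂ hQc hf
    refine ⟨hdegree hfc ?_ ((encode_lt_encode_of_mem ht).le.trans hsub), hcoeff hfc
      fun x hx => Or.inr (Or.inl (Set.mem_biUnion ht hx))⟩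
    rw [Fintype.card_fin]
    omega
  · intro x hx
    obtain ⟨t, ht, hlen, hval, h0, hxt⟩ := hD.pts_mem x hx
    refine ⟨fun i => h * FracCode.value p c (t.getD (i : ℕ) ([], [])), ?_, fun i => ?_⟩
    · have h1 := (hasCoords_mk _ h0).smul ((map_ne_zero (algebraMap K U)).2 hh)
      rw [← hxt] at h1
      convert h1 using 1
      funext i
      exact map_mul _ _ _
    · have hi : t.getD (i : ℕ) ([], []) ∈ t := by
        rw [List.getD_eq_getElem _ _ (by omega)]
        exact List.getElem_mem _
      exact hmono (hV _ (Or.inr (Or.inr (Set.mem_biUnion ht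
        (Set.mem_biUnion hi ⟨hval _ hi, rfl⟩)))))
  · rw [← hD.p_eq]
    exact hp.trans hEM
  · rw [← hD.q_eq, ← hD.r_eq]
    calc D.q ^ D.r ≤ M ^ D.r := Nat.pow_le_pow_left (hq.trans hEM) _
      _ ≤ M ^ M := Nat.pow_le_pow_right (by rw [hME]; positivity) (hr'.trans hEM)
  · rw [← hD.n_eq]
    exact hn.trans hEM

end Presentation

end

theorem mainTheorem9 :
    ∃ B : InputTuple → ℕ, Computable B ∧
      ∀ (p : ℕ) [Fact p.Prime] (k k' K U : Type*) [Field k] [Fintype k] [Field k'] [Fintype k']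
        [Field K] [Field U] [IsAlgClosed U]
        [Algebra k k'] [Algebra k' K] [Algebra k K] [IsScalarTower k k' K]
        [Algebra K U] [Algebra k U] [IsScalarTower k K U] [Algebra (ZMod p) K]
        (n r : ℕ) (G : CommAlgGroup k U n) (X S : Set G.Pts),
        0 < r →
        Fintype.card k' = Fintype.card k ^ r →
        (∀ c ∈ G.law, ∀ i, (c.coord i).totalDegree ≤ Fintype.card k ^ r) →
        (⊤ : IntermediateField k' K).FG →
        G.IsClosedSubvariety K X →
        S.Finite →
        (∀ x ∈ S, IsRationalPt K x.1) →
        (G.pullbackSets K X S r).Finite ∧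
          ∀ (D : InputCode) (c : Fin D.s → K), D.Presents p c G X S r →
            (G.pullbackSets K X S r).ncard ≤ B D.toTuple := by
  refine ⟨fun D => sizeBound (2 * (Encodable.encode D + 1) ^ 2), ?_, ?_⟩
  · have h : Primrec fun e : ℕ => sizeBound (2 * (e + 1) ^ 2) :=
      primrec_sizeBound.comp (Primrec.nat_mul.comp (Primrec.const 2)
        (primrec_pow.comp Primrec.succ (Primrec.const 2)))
    exact h.to_comp.comp Computable.encode
  · intro p _ k k' K U _ _ _ _ _ _ _ _ _ _ _ _ _ _ _ n r G X S hr _ hdeg hK hX hSfin hS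
    exact ⟨finite_pullbackSets_of_fg hK p G hr hdeg hX hSfin hS,
      fun D c hD => ncard_pullbackSets_le G hr hdeg D c hD⟩
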